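/- \textbf{Setting.} Let $n\ge 1$. Let $(Fu)(\xi)=\int_{\mathbb R^n}u(x)e^{-ix\xi}\,dx$ be the Fourier transform on the Schwartz space $S(\mathbb R^n)$; for $a\in S'(\mathbb R^n)$ and $u\in S(\mathbb R^n)$ the tempered distribution $F^{-1}aFu$ is given by $\langle F^{-1}aFu,v\rangle=\langle a,Fu\cdot F^{-1}v\rangle$. For a norm $\|f\|_X=\rho(|f|)$ defining a space $X$ of Lebesgue measurable functions $f:\mathbb R^n\to\mathbb C$, put $$\|a\|_{\mathcal M_X}=\sup\left\{\frac{\|F^{-1}aFu\|_X}{\|u\|_X}: u\in (S(\mathbb R^n)\cap X)\setminus\{0\}\right\},$$ where the norm of $F^{-1}aFu$ is $\infty$ if this distribution is not given by a function in $X$, and let $\mathcal M_X$ be the set of all $a\in S'(\mathbb R^n)$ with $\|a\|_{\mathcal M_X}<\infty$. Cubes $Q$ are nondegenerate, with sides parallel to the axes; $\chi_E$ denotes the characteristic function of $E$. A weight is a measurable $w:\mathbb R^n\to[0,\infty]$ with $0<w<\infty$ a.e.; $\|f\|_{L^p(\mathbb R^n,w)}:=\|fw\|_{L^p(\mathbb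 R^n)}$; and $w\in A_p(\mathbb R^n)$, $1<p<\infty$, $1/p+1/p'=1$, means $$\sup_Q\left(\frac1{|Q|}\int_Q w^p\right)^{1/p}\left(\frac1{|Q|}\int_Q w^{-p'}\right)^{1/p'}<\infty .$$ A Banach function norm is a map $\rho$ from the measurable functions $\mathbb R^n\to[0,\infty]$ to $[0,\infty]$ such that, for all such $f,g,f_j$, all constants $c\ge0$ and all measurable $E$: (A1) $\rho(f)=0\Leftrightarrow f=0$ a.e., $\rho(cf)=c\rho(f)$, $\rho(f+g)\le\rho(f)+\rho(g)$; (A2) $g\le f$ a.e. implies $\rho(g)\le\rho(f)$; (A3) $f_j\uparrow f$ a.e. implies $\rho(f_j)\uparrow\rho(f)$; (A4) $|E|<\infty$ implies $\rho(\chi_E)<\infty$; (A5) $|E|<\infty$ implies $\int_E f\le C_E\,\rho(f)$ with $C_E\in(0,\infty)$ independent of $f$. The Banach function space $X$ consists of the measurable $f$ with $\|f\|_X=\rho(|f|)<\infty$. Its associate norm is $\rho'(g)=\sup\{\int fg: f\ge0 \text{ measurable},\ \rho(f)\le1\}$, and $X$ satisfies the $A_X$-condition if $$\sup_Q |Q|^{-1}\rho(\chi_Q)\rho'(\chi_Q)<\infty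 .$$ \textbf{Statement.} (i) Let $1<p<\infty$, $w\in A_p(\mathbb R^n)$ and $X=L^p(\mathbb R^n,w)$. Then every $a\in\mathcal M_X$ is (given by a function) in $L^\infty(\mathbb R^n)$, and $\|a\|_{L^\infty(\mathbb R^n)}\le\|a\|_{\mathcal M_X}$. The constant $1$ is best possible for each such $X$: if $D\ge0$ is such that $\|a\|_{L^\infty(\mathbb R^n)}\le D\|a\|_{\mathcal M_X}$ for all $a\in\mathcal M_X\cap L^\infty(\mathbb R^n)$, then $D\ge1$. (ii) The same conclusions hold for every Banach function space $X$ on $\mathbb R^n$ that satisfies the $A_X$-condition. -/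

import Mathlib

open MeasureTheory Filter Topology
open scoped ENNReal NNReal SchwartzMap FourierTransform

noncomputable section

/-- The Euclidean space `ℝⁿ`. -/
abbrev Rn (n : ℕ) : Type := EuclideanSpace ℝ (Fin n)

/-! ### The Fourier transform with the kernel `exp (-i x ξ)` -/

/-- The dilation `x ↦ c x` of `ℝⁿ`, for `c ≠ 0`. -/
def dilation (n : ℕ) (c : ℝ) (hc : c ≠ 0) : Rn n ≃L[ℝ] Rn n :=
  ContinuousLinearEquiv.smulLeft (Units.mk0 c hc)

theorem dilation_apply (n : ℕ) (c : ℝ) (hc : c ≠ 0) (x : Rn n) : dilation n c hc x = c • x := rfl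

/-- The Fourier transform `(F u)(ξ) = ∫ u(x) exp (-i x ξ) dx` on the Schwartz space
(see `fourierS_apply`). -/
def fourierS (n : ℕ) : 𝓢(Rn n, ℂ) →L[ℂ] 𝓢(Rn n, ℂ) :=
  (SchwartzMap.compCLMOfContinuousLinearEquiv ℂ
    (dilation n (2 * Real.pi)⁻¹ (inv_ne_zero Real.two_pi_pos.ne'))) ∘L
      (FourierTransform.fourierCLM ℂ 𝓢(Rn n, ℂ))

/-- The inverse Fourier transform `(F⁻¹ v)(x) = (2π)⁻ⁿ ∫ v(ξ) exp (i x ξ) dξ` on the Schwartz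
space (see `fourierInvS_apply`). -/
def fourierInvS (n : ℕ) : 𝓢(Rn n, ℂ) →L[ℂ] 𝓢(Rn n, ℂ) :=
  (FourierTransform.fourierInvCLM ℂ 𝓢(Rn n, ℂ)) ∘L
    (SchwartzMap.compCLMOfContinuousLinearEquiv ℂ
      (dilation n (2 * Real.pi) Real.two_pi_pos.ne'))

theorem fourierS_apply (n : ℕ) (u : 𝓢(Rn n, ℂ)) (ξ : Rn n) :
    fourierS n u ξ = ∫ x, u x * Complex.exp (-(Complex.I * (inner ℝ x ξ : ℝ))) := by
  have h : fourierS n u ξ = (𝓕 u) ((2 * Real.pi)⁻¹ • ξ) := rfl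
  rw [h, SchwartzMap.fourier_coe, Real.fourier_eq']
  refine integral_congr_ae (Eventually.of_forall fun x => ?_)
  simp only [smul_eq_mul, inner_smul_right]
  rw [mul_comm]
  congr 2
  have : (Real.pi : ℂ) ≠ 0 := by exact_mod_cast Real.pi_ne_zero
  push_cast
  field_simp

theorem fourierInvS_apply (n : ℕ) (v : 𝓢(Rn n, ℂ)) (x : Rn n) :
    fourierInvS n v x = ((2 * Real.pi : ℝ) ^ n : ℝ)⁻¹ •
      ∫ ξ, v ξ * Complex.exp (Complex.I * (inner ℝ x ξ : ℝ)) := by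
  have h : fourierInvS n v x = (𝓕⁻ (SchwartzMap.compCLMOfContinuousLinearEquiv ℂ
      (dilation n (2 * Real.pi) Real.two_pi_pos.ne') v)) x := rfl
  rw [h, SchwartzMap.fourierInv_coe, Real.fourierInv_eq']
  have h2 := Measure.integral_comp_smul (volume : Measure (Rn n))
    (fun ξ => v ξ * Complex.exp (Complex.I * (inner ℝ x ξ : ℝ))) (2 * Real.pi)
  rw [finrank_euclideanSpace_fin, abs_of_pos (by positivity)] at h2
  rw [← h2]
  refine integral_congr_ae (Eventually.of_forall fun ξ => ?_)
  simp only [smul_eq_mul, inner_smul_right, SchwartzMap.compCLMOfContinuousLinearEquiv_apply,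
    Function.comp, dilation_apply]
  rw [mul_comm]
  congr 2
  rw [real_inner_comm]
  push_cast
  ring

theorem fourierInvS_fourierS (n : ℕ) (u : 𝓢(Rn n, ℂ)) : fourierInvS n (fourierS n u) = u := by
  have h : SchwartzMap.compCLMOfContinuousLinearEquiv ℂ
      (dilation n (2 * Real.pi) Real.two_pi_pos.ne') (fourierS n u) = 𝓕 u := by
    ext x
    change (𝓕 u) ((2 * Real.pi)⁻¹ • ((2 * Real.pi) • x)) = _
    rw [smul_smul, inv_mul_cancel₀ Real.two_pi_pos.ne', one_smul]
  change 𝓕⁻ (SchwartzMap.compCLMOfContinuousLinearEquiv ℂ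
      (dilation n (2 * Real.pi) Real.two_pi_pos.ne') (fourierS n u)) = u
  rw [h, FourierTransform.fourierInv_fourier_eq]

/-- The inverse Fourier transform on tempered distributions, `⟨F⁻¹ T, v⟩ = ⟨T, F⁻¹ v⟩`. -/
def fourierInvDist (n : ℕ) : 𝓢'(Rn n, ℂ) →L[ℂ] 𝓢'(Rn n, ℂ) :=
  PointwiseConvergenceCLM.precomp ℂ (fourierInvS n)

/-- The tempered distribution `F⁻¹ a F u`, for a symbol `a ∈ S'(ℝⁿ)` and `u ∈ S(ℝⁿ)`. -/
def multiplierOp {n : ℕ} (a : 𝓢'(Rn n, ℂ)) (u : 𝓢(Rn n, ℂ)) : 𝓢'(Rn n, ℂ) :=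
  fourierInvDist n (TemperedDistribution.smulLeftCLM ℂ (⇑(fourierS n u)) a)

/-! ### Function norms and Fourier multipliers -/

/-- The axioms (A1)-(A5) of a Banach function norm. Here `ρ` is only used on Lebesgue measurable
functions, that is, on the `AEMeasurable` ones; its values elsewhere are irrelevant. -/
structure IsBanachFunctionNorm {n : ℕ} (ρ : (Rn n → ℝ≥0∞) → ℝ≥0∞) : Prop where
  eq_zero_iff : ∀ f, AEMeasurable f volume → (ρ f = 0 ↔ f =ᵐ[volume] 0)
  const_mul : ∀ f, AEMeasurable f volume → ∀ c : ℝ≥0, ρ (fun x => c * f x) = c * ρ f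
  add_le : ∀ f g, AEMeasurable f volume → AEMeasurable g volume →
    ρ (fun x => f x + g x) ≤ ρ f + ρ g
  mono : ∀ f g, AEMeasurable f volume → AEMeasurable g volume → g ≤ᵐ[volume] f → ρ g ≤ ρ f
  fatou : ∀ (f : ℕ → Rn n → ℝ≥0∞) (g : Rn n → ℝ≥0∞),
    (∀ j, AEMeasurable (f j) volume) → AEMeasurable g volume →
    (∀ᵐ x, Monotone (fun j => f j x) ∧ Tendsto (fun j => f j x) atTop (𝓝 (g x))) →
    Monotone (fun j => ρ (f j)) ∧ Tendsto (fun j => ρ (f j)) atTop (𝓝 (ρ g))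
  indicator_lt_top : ∀ E : Set (Rn n), NullMeasurableSet E volume → volume E < ∞ →
    ρ (E.indicator 1) < ∞
  integral_le : ∀ E : Set (Rn n), NullMeasurableSet E volume → volume E < ∞ →
    ∃ C : ℝ≥0, 0 < C ∧ ∀ f, AEMeasurable f volume → ∫⁻ x in E, f x ≤ C * ρ f

/-- The associate norm `ρ'`. -/
def associateNorm {n : ℕ} (ρ : (Rn n → ℝ≥0∞) → ℝ≥0∞) (g : Rn n → ℝ≥0∞) : ℝ≥0∞ :=
  ⨆ (f : Rn n → ℝ≥0∞) (_ : AEMeasurable f volume) (_ : ρ f ≤ 1), ∫⁻ x, f x * g x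

/-- The tempered distribution `T` is regular and given by the function `f`. -/
structure IsGivenBy {n : ℕ} (T : 𝓢'(Rn n, ℂ)) (f : Rn n → ℂ) : Prop where
  aestronglyMeasurable : AEStronglyMeasurable f volume
  integrable : ∀ v : 𝓢(Rn n, ℂ), Integrable (fun x => f x * v x) volume
  eq_integral : ∀ v : 𝓢(Rn n, ℂ), T v = ∫ x, f x * v x

/-- The norm in the space `X` of functions `f` with `ρ(|f|) < ∞`, extended by `∞` outside `X`, of a
tempered distribution. The function that gives a regular distribution is unique almost
everywhere, so the infimum is over one value, or over none (and then is `∞`). -/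
def distNorm {n : ℕ} (ρ : (Rn n → ℝ≥0∞) → ℝ≥0∞) (T : 𝓢'(Rn n, ℂ)) : ℝ≥0∞ :=
  ⨅ (f : Rn n → ℂ) (_ : IsGivenBy T f), ρ (fun x => ‖f x‖ₑ)

/-- `‖a‖_{M_X}`, the supremum of `‖F⁻¹ a F u‖_X / ‖u‖_X` over the nonzero `u ∈ S(ℝⁿ) ∩ X`, where
`‖f‖_X = ρ(|f|)`. -/
def multiplierNorm {n : ℕ} (ρ : (Rn n → ℝ≥0∞) → ℝ≥0∞) (a : 𝓢'(Rn n, ℂ)) : ℝ≥0∞ :=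
  ⨆ (u : 𝓢(Rn n, ℂ)) (_ : u ≠ 0) (_ : ρ (fun x => ‖u x‖ₑ) < ∞),
    distNorm ρ (multiplierOp a u) / ρ (fun x => ‖u x‖ₑ)

/-- The set `M_X` of Fourier multipliers on `X`. -/
def multipliers {n : ℕ} (ρ : (Rn n → ℝ≥0∞) → ℝ≥0∞) : Set 𝓢'(Rn n, ℂ) :=
  {a | multiplierNorm ρ a < ∞}

/-! ### Cubes, the `A_X` condition, and Muckenhoupt weights -/

/-- The cube with sides of length `l` parallel to the axes and with lower corner `c`. -/
def axisCube {n : ℕ} (c : Rn n) (l : ℝ) : Set (Rn n) := {x | ∀ i, x i ∈ Set.Icc (c i) (c i + l)}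

/-- The `A_X`-condition `sup_Q |Q|⁻¹ ‖χ_Q‖_X ‖χ_Q‖_{X'} < ∞`. -/
def AXCondition {n : ℕ} (ρ : (Rn n → ℝ≥0∞) → ℝ≥0∞) : Prop :=
  ⨆ (c : Rn n) (l : ℝ) (_ : 0 < l), (volume (axisCube c l))⁻¹ *
    ρ ((axisCube c l).indicator 1) * associateNorm ρ ((axisCube c l).indicator 1) < ∞

/-- A weight: a measurable `w : ℝⁿ → [0, ∞]` with `0 < w < ∞` almost everywhere. -/
def IsWeight {n : ℕ} (w : Rn n → ℝ≥0∞) : Prop :=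
  AEMeasurable w volume ∧ ∀ᵐ x, 0 < w x ∧ w x < ∞

/-- `w ∈ A_p(ℝⁿ)`, in the normalization where the norm of `L^p(ℝⁿ, w)` is `‖f w‖_p`. -/
def IsMuckenhoupt {n : ℕ} (p : ℝ) (w : Rn n → ℝ≥0∞) : Prop :=
  IsWeight w ∧
  ⨆ (c : Rn n) (l : ℝ) (_ : 0 < l),
    ((volume (axisCube c l))⁻¹ * ∫⁻ x in axisCube c l, w x ^ p) ^ (1 / p) *
    ((volume (axisCube c l))⁻¹ * ∫⁻ x in axisCube c l, w x ^ (-p.conjExponent)) ^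
      (1 / p.conjExponent) < ∞

/-- The norm of `L^p(ℝⁿ, w)`, `f ↦ ‖f w‖_{L^p(ℝⁿ)}`, on nonnegative functions. -/
def weightedLpNorm {n : ℕ} (p : ℝ) (w : Rn n → ℝ≥0∞) (f : Rn n → ℝ≥0∞) : ℝ≥0∞ :=
  (∫⁻ x, (f x * w x) ^ p) ^ (1 / p)

end

/-! The norm enters only through the values V(R) = ρ(χ_B(R)) on centred balls and through the
`AXCondition`. Since ρ'(χ_Q) stays away from 0 for cubes Q containing a fixed one, that condition
forces V(R) ≤ C R^n. Hence V cannot grow faster than R^n at all large scales: for τ > 1 and t > τ^n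
there are arbitrarily large R with V(τR) ≤ t V(R) (`IsLatticeNorm.exists_ball_dilate_le`). This
replaces translation or dilation invariance of the norm and is what produces the constant 1.

The symbol is first shown to be a bounded function, with a poor constant. For u, v bounded by 1 and
supported in a ball of radius S, Hölder for ρ, ρ' and the `AXCondition` give |⟨a, 𝓕u · 𝓕⁻v⟩| ≤ A
S^n. Modulating a bump of width R in both slots bounds a on all translates of a kernel of mass
comparable to R^n concentrated at scale 1/R. Averaging the translates against ψ and letting R → ∞
yields |⟨a, ψ⟩| ≤ C‖ψ‖₁ (`IsBoundedMultiplier.exists_norm_le_integral`), so a is some b in L^∞.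

The sharp constant comes from a Lebesgue point ξ₀ of b. Let u be the wave of frequency ξ₀ cut off by
a bump equal to 1 on B(R) and vanishing outside B(τR). As 𝓕u concentrates at ξ₀, the image of u
differs uniformly by little from b(ξ₀)u. Thus (|b(ξ₀)| - ε) V(R) ≤ M V(τR) ≤ M t V(R) along good
radii R, and τ, t → 1 gives |b(ξ₀)| ≤ M (`IsBoundedMultiplier.norm_le_of_lebesgue_point`).

Weighted L^p with an A_p weight is a special case, because Hölder turns A_p into the `AXCondition`.
The symbol 1 shows that the constant is optimal. -/

namespace SchwartzMap

/-! ### Dilations, translations and products of Schwartz functions. -/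

/-- The dilation `u ↦ u (c ·)` of Schwartz functions. -/
noncomputable def dil {n : ℕ} (c : ℝ) (hc : c ≠ 0) : 𝓢(Rn n, ℂ) →L[ℂ] 𝓢(Rn n, ℂ) :=
  compCLMOfContinuousLinearEquiv ℂ (dilation n c hc)

theorem dil_apply {n : ℕ} {c : ℝ} (hc : c ≠ 0) (u : 𝓢(Rn n, ℂ)) (x : Rn n) :
    dil c hc u x = u (c • x) := rfl

/-- The pointwise product of Schwartz functions. -/
noncomputable def prod {n : ℕ} (f g : 𝓢(Rn n, ℂ)) : 𝓢(Rn n, ℂ) :=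
  pairing (ContinuousLinearMap.mul ℂ ℂ) f g

theorem prod_apply {n : ℕ} (f g : 𝓢(Rn n, ℂ)) (x : Rn n) : prod f g x = f x * g x := rfl

/-- Translation of Schwartz functions. -/
noncomputable abbrev trans {n : ℕ} (ξ : Rn n) (f : 𝓢(Rn n, ℂ)) : 𝓢(Rn n, ℂ) :=
  compSubConstCLM ℂ ξ f

theorem integral_comp_smul_eq {n : ℕ} (f : Rn n → ℂ) {c : ℝ} :
    ∫ x, f (c • x) = ((|c| ^ n)⁻¹ : ℝ) • ∫ x, f x := by
  have := Measure.integral_comp_smul (volume : Measure (Rn n)) f c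
  rwa [finrank_euclideanSpace_fin, abs_inv, abs_pow] at this

theorem fourier_dil {n : ℕ} {c : ℝ} (hc : c ≠ 0) (u : 𝓢(Rn n, ℂ)) :
    𝓕 (dil c hc u) = ((|c| ^ n)⁻¹ : ℝ) • dil c⁻¹ (inv_ne_zero hc) (𝓕 u) := by
  ext x
  rw [smul_apply, dil_apply, fourier_coe, fourier_coe, Real.fourier_eq', Real.fourier_eq',
    ← integral_comp_smul_eq]
  refine integral_congr_ae (Eventually.of_forall fun y => ?_)
  simp only [dil_apply, inner_smul_left, inner_smul_right]
  congr 3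
  simp [hc]

theorem fourierInv_dil {n : ℕ} {c : ℝ} (hc : c ≠ 0) (u : 𝓢(Rn n, ℂ)) :
    𝓕⁻ (dil c hc u) = ((|c| ^ n)⁻¹ : ℝ) • dil c⁻¹ (inv_ne_zero hc) (𝓕⁻ u) := by
  ext x
  rw [smul_apply, dil_apply, fourierInv_coe, fourierInv_coe, Real.fourierInv_eq',
    Real.fourierInv_eq', ← integral_comp_smul_eq]
  refine integral_congr_ae (Eventually.of_forall fun y => ?_)
  simp only [dil_apply, inner_smul_left, inner_smul_right]
  congr 3
  simp [hc]

theorem fourier_trans {n : ℕ} (ξ : Rn n) (h : 𝓢(Rn n, ℂ)) (x : Rn n) :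
    𝓕 (trans ξ h) x = (Real.fourierChar (-(inner ℝ ξ x))) • 𝓕 h x := by
  rw [fourier_coe, fourier_coe, Real.fourier_eq, Real.fourier_eq]
  simp only [Circle.smul_def]
  rw [← integral_smul, ← integral_add_right_eq_self _ ξ]
  refine integral_congr_ae (Eventually.of_forall fun y => ?_)
  simp only [compSubConstCLM_apply, add_sub_cancel_right, inner_add_left, neg_add_rev, smul_smul,
    AddChar.map_add_eq_mul, Circle.coe_mul]

theorem fourierInv_trans {n : ℕ} (ξ : Rn n) (h : 𝓢(Rn n, ℂ)) (x : Rn n) :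
    𝓕⁻ (trans ξ h) x = (Real.fourierChar (inner ℝ ξ x)) • 𝓕⁻ h x := by
  rw [fourierInv_coe, fourierInv_coe, Real.fourierInv_eq, Real.fourierInv_eq]
  simp only [Circle.smul_def]
  rw [← integral_smul, ← integral_add_right_eq_self _ ξ]
  refine integral_congr_ae (Eventually.of_forall fun y => ?_)
  simp only [compSubConstCLM_apply, add_sub_cancel_right, inner_add_left, smul_smul,
    AddChar.map_add_eq_mul, Circle.coe_mul]
  rw [mul_comm]

theorem norm_fourier_trans {n : ℕ} (ξ : Rn n) (h : 𝓢(Rn n, ℂ)) (x : Rn n) :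
    ‖𝓕 (trans ξ h) x‖ = ‖𝓕 h x‖ := by
  rw [fourier_trans, Circle.norm_smul]

theorem norm_fourierInv_trans {n : ℕ} (ξ : Rn n) (h : 𝓢(Rn n, ℂ)) (x : Rn n) :
    ‖𝓕⁻ (trans ξ h) x‖ = ‖𝓕⁻ h x‖ := by
  rw [fourierInv_trans, Circle.norm_smul]

/-- The mean value inequality gives order 0, at the price of a factor ‖x‖. For i ≥ 1 the chain rule
gives |c|^i ≤ |c|. -/
theorem norm_iteratedFDeriv_dil_sub_le {n : ℕ} (θ : 𝓢(Rn n, ℂ)) (i : ℕ) :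
    ∃ A : ℝ, 0 ≤ A ∧ ∀ c : ℝ, |c| ≤ 1 → ∀ x : Rn n,
      ‖iteratedFDeriv ℝ i (fun x => θ (c • x) - θ 0) x‖ ≤ |c| * (A * (1 + ‖x‖)) := by
  rcases Nat.eq_zero_or_pos i with rfl | hi
  · refine ⟨SchwartzMap.seminorm ℝ 0 1 θ, by positivity, fun c _ x => ?_⟩
    rw [norm_iteratedFDeriv_zero]
    have h := Convex.norm_image_sub_le_of_norm_fderiv_le (𝕜 := ℝ) (f := θ) (s := Set.univ)
      (C := SchwartzMap.seminorm ℝ 0 1 θ) (x := 0) (y := c • x)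
      (fun x _ => θ.differentiableAt) (fun x _ => by
        have := θ.norm_iteratedFDeriv_le_seminorm ℝ 1 x
        rwa [norm_iteratedFDeriv_one] at this) convex_univ (Set.mem_univ _) (Set.mem_univ _)
    refine h.trans ?_
    rw [sub_zero, norm_smul, Real.norm_eq_abs]
    have : 0 ≤ SchwartzMap.seminorm ℝ 0 1 θ := by positivity
    nlinarith [abs_nonneg c, mul_nonneg this (abs_nonneg c)]
  · refine ⟨SchwartzMap.seminorm ℝ 0 i θ, by positivity, fun c hc x => ?_⟩
    rw [fun_iteratedFDeriv_sub_apply, iteratedFDeriv_const_of_ne hi.ne', Pi.zero_apply, sub_zero,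
      iteratedFDeriv_comp_const_smul c (θ.smooth i), norm_smul, norm_pow, Real.norm_eq_abs]
    · have h1 := θ.norm_iteratedFDeriv_le_seminorm ℝ i (c • x)
      have h2 : |c| ^ i ≤ |c| := pow_le_of_le_one (abs_nonneg c) hc hi.ne'
      have h3 : 0 ≤ SchwartzMap.seminorm ℝ 0 i θ := by positivity
      gcongr
      nlinarith [norm_nonneg x, mul_nonneg h3 (norm_nonneg x)]
    · exact ((θ.smooth i).comp (contDiff_const_smul c)).contDiffAt
    · exact contDiffAt_const

/-- Leibniz rule: the growth 1 + ‖x‖ of the first factor is absorbed by the decay of g, which costs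
one more power in its seminorms. -/
theorem seminorm_prod_dil_sub_le {n : ℕ} (θ g : 𝓢(Rn n, ℂ)) (k l : ℕ) :
    ∃ B : ℝ, ∀ (c : ℝ) (hc : c ≠ 0), |c| ≤ 1 →
      SchwartzMap.seminorm ℂ k l (prod (dil c hc θ) g - θ 0 • g) ≤ |c| * B := by
  choose A hA0 hA using norm_iteratedFDeriv_dil_sub_le θ
  have hB0 : ∀ i, 0 ≤ (l.choose i : ℝ) * A i *
      (SchwartzMap.seminorm ℝ k (l - i) g + SchwartzMap.seminorm ℝ (k + 1) (l - i) g) := fun i =>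
    mul_nonneg (mul_nonneg (Nat.cast_nonneg _) (hA0 i)) (by positivity)
  refine ⟨∑ i ∈ Finset.range (l + 1), (l.choose i : ℝ) * A i *
    (SchwartzMap.seminorm ℝ k (l - i) g + SchwartzMap.seminorm ℝ (k + 1) (l - i) g),
    fun c hc hc1 => ?_⟩
  refine seminorm_le_bound ℂ k l _
    (mul_nonneg (abs_nonneg c) (Finset.sum_nonneg fun i _ => hB0 i)) fun x => ?_
  have heq : (⇑(prod (dil c hc θ) g - θ 0 • g) : Rn n → ℂ) =
      fun x => (θ (c • x) - θ 0) * g x := by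
    ext x
    rw [sub_apply, prod_apply, dil_apply, smul_apply, smul_eq_mul, sub_mul]
  rw [heq]
  have h1 := norm_iteratedFDeriv_mul_le (𝕜 := ℝ) (f := fun x => θ (c • x) - θ 0) (g := g) (N := l)
    (((θ.smooth l).comp (contDiff_const_smul c)).sub contDiff_const) (g.smooth l) x (n := l) le_rfl
  refine (mul_le_mul_of_nonneg_left h1 (by positivity)).trans ?_
  rw [Finset.mul_sum, Finset.mul_sum]
  refine Finset.sum_le_sum fun i _ => ?_
  have h2 := hA i c hc1 x
  have h3 := g.le_seminorm ℝ k (l - i) x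
  have h4 := g.le_seminorm ℝ (k + 1) (l - i) x
  calc ‖x‖ ^ k * ((l.choose i : ℝ) * ‖iteratedFDeriv ℝ i (fun x => θ (c • x) - θ 0) x‖ *
        ‖iteratedFDeriv ℝ (l - i) g x‖)
      ≤ ‖x‖ ^ k * ((l.choose i : ℝ) * (|c| * (A i * (1 + ‖x‖))) *
        ‖iteratedFDeriv ℝ (l - i) g x‖) := by gcongr
    _ = |c| * ((l.choose i : ℝ) * A i * (‖x‖ ^ k * ‖iteratedFDeriv ℝ (l - i) g x‖ +
        ‖x‖ ^ (k + 1) * ‖iteratedFDeriv ℝ (l - i) g x‖)) := by ring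
    _ ≤ _ := by
      have := hA0 i
      gcongr

theorem tendsto_prod_dil {n : ℕ} (θ g : 𝓢(Rn n, ℂ)) {c : ℕ → ℝ} (hc : ∀ j, c j ≠ 0)
    (hlim : Tendsto c atTop (𝓝 0)) :
    Tendsto (fun j => prod (dil (c j) (hc j) θ) g) atTop (𝓝 (θ 0 • g)) := by
  rw [(schwartz_withSeminorms ℂ (Rn n) ℂ).tendsto_nhds]
  rintro ⟨k, l⟩ ε hε
  obtain ⟨B, hB⟩ := seminorm_prod_dil_sub_le θ g k l
  have h0 : Tendsto (fun j => |c j|) atTop (𝓝 0) := by simpa using hlim.abs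
  have h1 : Tendsto (fun j => |c j| * B) atTop (𝓝 0) := by simpa using h0.mul_const B
  have h2 : ∀ᶠ j in atTop, |c j| < 1 := h0.eventually_lt_const one_pos
  filter_upwards [h1.eventually_lt_const hε, h2] with j hj hj2
  exact (hB (c j) (hc j) hj2.le).trans_lt hj

end SchwartzMap

/-! ### Functionals on the Schwartz space bounded in the L^1 norm. -/

/-- Reflected and translated mollifiers are test functions of L^1 norm 1, and the mollifications of
f converge to f almost everywhere. -/
theorem ae_norm_le_of_forall_schwartz {n : ℕ} {f : Rn n → ℂ} (hf : LocallyIntegrable f volume)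
    {C : ℝ} (h : ∀ ψ : 𝓢(Rn n, ℂ), ‖∫ x, f x * ψ x‖ ≤ C * ∫ x, ‖ψ x‖) :
    ∀ᵐ x, ‖f x‖ ≤ C := by
  let φ : ℕ → ContDiffBump (0 : Rn n) := fun j =>
    ⟨1 / ((j : ℝ) + 1), 2 / ((j : ℝ) + 1), by positivity, by gcongr; norm_num⟩
  have hφ : Tendsto (fun j => (φ j).rOut) atTop (𝓝 0) := by
    have := (tendsto_one_div_add_atTop_nhds_zero_nat (𝕜 := ℝ)).const_mul 2
    rw [mul_zero] at this
    exact this.congr fun j => by simp [φ]; ring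
  have hφ' : ∀ᶠ j in atTop, (φ j).rOut ≤ 2 * (φ j).rIn :=
    Eventually.of_forall fun j => by simp [φ]; apply le_of_eq; ring
  filter_upwards [ContDiffBump.ae_convolution_tendsto_right_of_locallyIntegrable hφ hφ' hf]
    with x hx
  refine le_of_tendsto hx.norm (Eventually.of_forall fun j => ?_)
  have hs : HasCompactSupport (fun t : Rn n => ((φ j).normed volume (x - t) : ℂ)) :=
    ((φ j).hasCompactSupport_normed.comp_homeomorph (Homeomorph.subLeft x)).comp_left
      (g := Complex.ofReal) rfl
  have hd : ContDiff ℝ ((⊤ : ℕ∞) : WithTop ℕ∞) (fun t : Rn n => ((φ j).normed volume (x - t) : ℂ)) :=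
    Complex.ofRealCLM.contDiff.comp
      ((φ j).contDiff_normed.comp (contDiff_const.sub contDiff_id))
  have h1 := h (hs.toSchwartzMap hd)
  have h2 : ∫ t, ‖hs.toSchwartzMap hd t‖ = 1 := by
    change ∫ t, ‖((φ j).normed volume (x - t) : ℂ)‖ = 1
    simp_rw [Complex.norm_real, Real.norm_of_nonneg ((φ j).nonneg_normed _)]
    rw [integral_sub_left_eq_self (fun t => (φ j).normed volume t)]
    exact (φ j).integral_normed
  rw [h2, mul_one] at h1
  refine le_trans (le_of_eq (congrArg norm ?_)) h1
  rw [MeasureTheory.convolution_eq_swap]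
  refine integral_congr_ae (Eventually.of_forall fun t => ?_)
  change (φ j).normed volume (x - t) • f t = f t * ((φ j).normed volume (x - t) : ℂ)
  rw [Complex.real_smul, mul_comm]

theorem locallyIntegrable_of_forall_schwartz {n : ℕ} {f : Rn n → ℂ}
    (h : ∀ v : 𝓢(Rn n, ℂ), Integrable (fun x => f x * v x) volume) :
    LocallyIntegrable f volume := by
  rw [locallyIntegrable_iff]
  intro K hK
  obtain ⟨r, hr0, hr⟩ := hK.isBounded.subset_closedBall_lt 0 0
  let φ : ContDiffBump (0 : Rn n) := ⟨r, r + 1, hr0, by linarith⟩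
  have hs : HasCompactSupport (fun t : Rn n => (φ t : ℂ)) :=
    φ.hasCompactSupport.comp_left (g := Complex.ofReal) rfl
  have hd : ContDiff ℝ ((⊤ : ℕ∞) : WithTop ℕ∞) (fun t : Rn n => (φ t : ℂ)) := Complex.ofRealCLM.contDiff.comp φ.contDiff
  refine (h (hs.toSchwartzMap hd)).integrableOn.congr_fun_ae ?_
  refine (ae_restrict_iff' hK.measurableSet).2 (Eventually.of_forall fun x hx => ?_)
  change f x * (φ x : ℂ) = f x
  rw [φ.one_of_mem_closedBall (hr hx), Complex.ofReal_one, mul_one]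

theorem IsGivenBy.locallyIntegrable {n : ℕ} {T : 𝓢'(Rn n, ℂ)} {f : Rn n → ℂ}
    (hf : IsGivenBy T f) : LocallyIntegrable f volume :=
  locallyIntegrable_of_forall_schwartz hf.integrable

theorem IsGivenBy.ae_eq {n : ℕ} {T : 𝓢'(Rn n, ℂ)} {f g : Rn n → ℂ}
    (hf : IsGivenBy T f) (hg : IsGivenBy T g) : f =ᵐ[volume] g := by
  have h := ae_norm_le_of_forall_schwartz (C := 0) (hf.locallyIntegrable.sub hg.locallyIntegrable)
    fun ψ => by
      simp only [Pi.sub_apply, sub_mul]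
      rw [integral_sub (hf.integrable ψ) (hg.integrable ψ), ← hf.eq_integral, ← hg.eq_integral]
      simp
  filter_upwards [h] with x hx
  exact sub_eq_zero.1 (norm_le_zero_iff.1 hx)

/-- After multiplication by a square integrable power of 1 + ‖x‖², the functional is bounded in L^2
by Cauchy-Schwarz, so the Riesz theorem represents it by a function. The L^∞ bound is then recovered
from the L^1 bound by mollification. -/
theorem exists_bounded_of_forall_schwartz {n : ℕ} (a : 𝓢'(Rn n, ℂ)) {C : ℝ} (hC : 0 ≤ C)
    (h : ∀ ψ : 𝓢(Rn n, ℂ), ‖a ψ‖ ≤ C * ∫ x, ‖ψ x‖) :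
    ∃ b : Rn n → ℂ, IsGivenBy a b ∧ ∀ᵐ x, ‖b x‖ ≤ C := by
  let G : ℝ → Rn n → ℂ := fun r x => (((1 + ‖x‖ ^ 2) ^ r : ℝ) : ℂ)
  have hG : ∀ r, (G r).HasTemperateGrowth := fun r =>
    Function.Complex.hasTemperateGrowth_ofReal.comp
      (Function.hasTemperateGrowth_one_add_norm_sq_rpow (Rn n) r)
  -- Square integrability of (1 + ‖x‖²)^(-r) needs 4r > n; here 4r = 2n + 2.
  set r : ℝ := ((n : ℝ) + 1) / 2 with hr
  have hGr : ∀ x, G r x * G (-r) x = 1 := fun x => by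
    simp only [G]
    rw [← Complex.ofReal_mul, ← Real.rpow_add (by positivity), add_neg_cancel, Real.rpow_zero,
      Complex.ofReal_one]
  have hGnorm : ∀ x, ‖G (-r) x‖ = (1 + ‖x‖ ^ 2) ^ (-r) := fun x => by
    simp only [G]
    rw [Complex.norm_real, Real.norm_of_nonneg (by positivity)]
  have hGint : Integrable (fun x => ‖G (-r) x‖ ^ (2 : ℝ)) (volume : Measure (Rn n)) := by
    have := integrable_rpow_neg_one_add_norm_sq (E := Rn n) (μ := volume) (r := 4 * r)
      (by rw [finrank_euclideanSpace_fin, hr]; have : (0 : ℝ) ≤ n := Nat.cast_nonneg n; linarith)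
    refine this.congr (Eventually.of_forall fun x => ?_)
    simp only
    rw [hGnorm, ← Real.rpow_mul (by positivity)]
    congr 1
    ring
  have hGmem : MemLp (G (-r)) (ENNReal.ofReal 2) volume := by
    have hm : AEStronglyMeasurable (G (-r)) (volume : Measure (Rn n)) :=
      (hG (-r)).1.continuous.aestronglyMeasurable
    have h2 := (integrable_norm_rpow_iff hm (p := 2) (by norm_num) (by norm_num)).1
      (by simpa using hGint)
    simpa using h2
  set e : 𝓢(Rn n, ℂ) →ₗ[ℂ] Lp ℂ 2 (volume : Measure (Rn n)) :=
    (SchwartzMap.toLpCLM ℂ ℂ 2 volume).toLinearMap with he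
  set f : 𝓢(Rn n, ℂ) →ₗ[ℂ] ℂ :=
    a.toLinearMap ∘ₗ (SchwartzMap.smulLeftCLM ℂ (G (-r))).toLinearMap with hf
  have hdense : DenseRange e := SchwartzMap.denseRange_toLpCLM (by norm_num)
  set B : ℝ := (∫ x, ‖G (-r) x‖ ^ (2 : ℝ)) ^ (1 / (2 : ℝ)) with hB
  have hbound : ∀ w, ‖f w‖ ≤ C * B * ‖e w‖ := fun w => by
    refine (h _).trans ?_
    rw [mul_assoc]
    refine mul_le_mul_of_nonneg_left ?_ hC
    have h1 := integral_mul_norm_le_Lp_mul_Lq (μ := (volume : Measure (Rn n)))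
      (Real.HolderConjugate.two_two) (f := G (-r)) (g := w) hGmem (by simpa using w.memLp 2)
    have h2 : ‖e w‖ = (∫ x, ‖w x‖ ^ (2 : ℝ)) ^ (1 / (2 : ℝ)) := by
      have := w.norm_toLp' (p := 2) (μ := volume) (by norm_num) (by norm_num)
      rw [ENNReal.toReal_ofNat, ← one_div] at this
      exact this
    rw [h2]
    refine le_trans (le_of_eq (integral_congr_ae (Eventually.of_forall fun x => ?_))) h1
    change ‖SchwartzMap.smulLeftCLM ℂ (G (-r)) w x‖ = _
    rw [SchwartzMap.smulLeftCLM_apply_apply (hG _), norm_smul]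
  set ℓ := f.extendOfNorm e with hℓ
  set hh := (InnerProductSpace.toDual ℂ (Lp ℂ 2 (volume : Measure (Rn n)))).symm ℓ with hhh
  have hrep : ∀ v : 𝓢(Rn n, ℂ), a v = ∫ x, (starRingEnd ℂ) (hh x) * G r x * v x := fun v => by
    set w := SchwartzMap.smulLeftCLM ℂ (G r) v with hw
    have h1 : f w = a v := by
      simp only [hf, LinearMap.comp_apply]
      change a (SchwartzMap.smulLeftCLM ℂ (G (-r)) w) = a v
      congr 1
      ext x
      rw [SchwartzMap.smulLeftCLM_apply_apply (hG _), hw,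
        SchwartzMap.smulLeftCLM_apply_apply (hG _), smul_smul, mul_comm, hGr, one_smul]
    rw [← h1, ← LinearMap.extendOfNorm_eq hdense ⟨_, hbound⟩ w, ← hℓ,
      ← InnerProductSpace.toDual_symm_apply (𝕜 := ℂ) (y := ℓ), ← hhh, L2.inner_def]
    refine integral_congr_ae ?_
    filter_upwards [w.coeFn_toLp 2 volume] with x hx
    change inner ℂ (hh x) (w.toLp 2 volume x) = _
    rw [hx, hw, SchwartzMap.smulLeftCLM_apply_apply (hG _), RCLike.inner_apply]
    simp only [smul_eq_mul]
    ring
  have hint : ∀ v : 𝓢(Rn n, ℂ),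
      Integrable (fun x => (starRingEnd ℂ) (hh x) * G r x * v x) volume := fun v => by
    set w := SchwartzMap.smulLeftCLM ℂ (G r) v with hw
    have h1 := L2.integrable_inner (𝕜 := ℂ) hh (w.toLp 2 volume)
    refine h1.congr ?_
    filter_upwards [w.coeFn_toLp 2 volume] with x hx
    rw [hx, hw, SchwartzMap.smulLeftCLM_apply_apply (hG _), RCLike.inner_apply]
    simp only [smul_eq_mul]
    ring
  have hmeas : AEStronglyMeasurable (fun x => (starRingEnd ℂ) (hh x) * G r x) volume :=
    (RCLike.continuous_conj.comp_aestronglyMeasurable (Lp.aestronglyMeasurable hh)).mul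
      (hG r).1.continuous.aestronglyMeasurable
  refine ⟨_, ⟨hmeas, hint, hrep⟩, ?_⟩
  refine ae_norm_le_of_forall_schwartz (locallyIntegrable_of_forall_schwartz hint) fun ψ => ?_
  rw [← hrep]
  exact h ψ

/-! ### Lattice norms and the growth of the norms of balls. -/

/-- The properties of a function norm that are shared by Banach function norms and weighted
`L^p`-norms with Muckenhoupt weights. -/
structure IsLatticeNorm {n : ℕ} (ρ : (Rn n → ℝ≥0∞) → ℝ≥0∞) : Prop where
  ae_eq_zero : ∀ f, AEMeasurable f volume → ρ f = 0 → f =ᵐ[volume] 0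
  const_mul : ∀ f, AEMeasurable f volume → ∀ c : ℝ≥0, ρ (fun x => c * f x) = c * ρ f
  add_le : ∀ f g, AEMeasurable f volume → AEMeasurable g volume →
    ρ (fun x => f x + g x) ≤ ρ f + ρ g
  mono : ∀ f g, AEMeasurable f volume → AEMeasurable g volume → g ≤ᵐ[volume] f → ρ g ≤ ρ f
  cube_lt_top : ∀ (c : Rn n) (l : ℝ), 0 < l → ρ ((axisCube c l).indicator 1) < ∞

/-- The cube `[-R, R]ⁿ`. -/
def centeredCube (n : ℕ) (R : ℝ) : Set (Rn n) := axisCube (WithLp.toLp 2 fun _ => -R) (2 * R)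

theorem axisCube_eq_preimage {n : ℕ} (c : Rn n) (l : ℝ) :
    axisCube c l = (fun x : Rn n => x.ofLp) ⁻¹' Set.Icc c.ofLp (fun i => c i + l) := by
  ext x
  simp only [axisCube, Set.mem_ofPred_eq, Set.mem_Icc, Set.mem_preimage, Pi.le_def]
  exact forall_and

theorem volume_axisCube {n : ℕ} (c : Rn n) (l : ℝ) :
    volume (axisCube c l) = ENNReal.ofReal l ^ n := by
  rw [axisCube_eq_preimage, (PiLp.volume_preserving_ofLp (Fin n)).measure_preimage
    measurableSet_Icc.nullMeasurableSet, Real.volume_Icc_pi]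
  simp

theorem measurableSet_axisCube {n : ℕ} (c : Rn n) (l : ℝ) : MeasurableSet (axisCube c l) := by
  rw [axisCube_eq_preimage]
  exact (PiLp.volume_preserving_ofLp (Fin n)).measurable measurableSet_Icc

theorem volume_axisCube_ne_zero {n : ℕ} (c : Rn n) {l : ℝ} (hl : 0 < l) :
    volume (axisCube c l) ≠ 0 := by
  rw [volume_axisCube]
  exact pow_ne_zero _ (ENNReal.ofReal_pos.2 hl).ne'

theorem volume_axisCube_ne_top {n : ℕ} (c : Rn n) (l : ℝ) : volume (axisCube c l) ≠ ∞ := by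
  rw [volume_axisCube]
  exact ENNReal.pow_ne_top ENNReal.ofReal_ne_top

theorem measurableSet_centeredCube (n : ℕ) (R : ℝ) : MeasurableSet (centeredCube n R) :=
  measurableSet_axisCube _ _

theorem closedBall_subset_centeredCube {n : ℕ} (R : ℝ) :
    Metric.closedBall (0 : Rn n) R ⊆ centeredCube n R := by
  intro x hx i
  have h1 : ‖x‖ ≤ R := by simpa using hx
  have h2 : |x i| ≤ R := (PiLp.norm_apply_le x i).trans h1
  have := abs_le.1 h2
  exact ⟨this.1, by change x i ≤ -R + 2 * R; linarith [this.2]⟩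

theorem centeredCube_mono {n : ℕ} {R S : ℝ} (h : R ≤ S) : centeredCube n R ⊆ centeredCube n S := by
  intro x hx i
  have := hx i
  change -R ≤ x i ∧ x i ≤ -R + 2 * R at this
  change -S ≤ x i ∧ x i ≤ -S + 2 * S
  constructor <;> linarith [this.1, this.2]

theorem aemeasurable_indicator_one {n : ℕ} {E : Set (Rn n)} (hE : MeasurableSet E) :
    AEMeasurable (E.indicator (1 : Rn n → ℝ≥0∞)) volume :=
  (measurable_one.indicator hE).aemeasurable

theorem associateNorm_mono {n : ℕ} (ρ : (Rn n → ℝ≥0∞) → ℝ≥0∞) {g h : Rn n → ℝ≥0∞} (hgh : g ≤ h) :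
    associateNorm ρ g ≤ associateNorm ρ h := by
  refine iSup_mono fun f => iSup_mono fun _ => iSup_mono fun _ => lintegral_mono fun x => ?_
  have := hgh x
  gcongr

namespace IsLatticeNorm

variable {n : ℕ} {ρ : (Rn n → ℝ≥0∞) → ℝ≥0∞}

theorem map_zero (h : IsLatticeNorm ρ) : ρ (fun _ => 0) = 0 := by
  simpa using h.const_mul (fun _ => 0) aemeasurable_const 0

theorem congr (h : IsLatticeNorm ρ) {f g : Rn n → ℝ≥0∞} (hf : AEMeasurable f volume)
    (hfg : f =ᵐ[volume] g) : ρ f = ρ g :=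
  le_antisymm (h.mono _ _ (hf.congr hfg) hf hfg.le) (h.mono _ _ hf (hf.congr hfg) hfg.symm.le)

theorem lintegral_mul_le (h : IsLatticeNorm ρ) {f g : Rn n → ℝ≥0∞} (hf : AEMeasurable f volume)
    (hfin : ρ f ≠ ∞) : ∫⁻ x, f x * g x ≤ ρ f * associateNorm ρ g := by
  by_cases h0 : ρ f = 0
  · have : ∫⁻ x, f x * g x = 0 := by
      rw [← lintegral_zero (μ := (volume : Measure (Rn n)))]
      refine lintegral_congr_ae ?_
      filter_upwards [h.ae_eq_zero f hf h0] with x hx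
      simp [hx]
    rw [this]
    exact zero_le
  · have hc : (ρ f)⁻¹ ≠ ∞ := ENNReal.inv_ne_top.2 h0
    obtain ⟨c, hc'⟩ : ∃ c : ℝ≥0, (c : ℝ≥0∞) = (ρ f)⁻¹ := ⟨_, ENNReal.coe_toNNReal hc⟩
    have h1 : ρ (fun x => c * f x) ≤ 1 := by
      rw [h.const_mul f hf, hc', ENNReal.inv_mul_cancel h0 hfin]
    have h2 : ∫⁻ x, (c * f x) * g x ≤ associateNorm ρ g :=
      le_iSup₂_of_le (fun x => c * f x) (hf.const_mul _) (le_iSup_of_le h1 le_rfl)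
    simp_rw [mul_assoc] at h2
    rw [lintegral_const_mul' _ _ ENNReal.coe_ne_top, hc'] at h2
    calc ∫⁻ x, f x * g x = ρ f * ((ρ f)⁻¹ * ∫⁻ x, f x * g x) := by
          rw [← mul_assoc, ENNReal.mul_inv_cancel h0 hfin, one_mul]
      _ ≤ _ := by gcongr

theorem exists_mul_associateNorm_le (hAX : AXCondition ρ) :
    ∃ A : ℝ≥0, ∀ R : ℝ, 0 < R → ρ ((centeredCube n R).indicator 1) *
      associateNorm ρ ((centeredCube n R).indicator 1) ≤ A * ENNReal.ofReal (2 * R) ^ n := by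
  obtain ⟨A, hA⟩ : ∃ A : ℝ≥0, (A : ℝ≥0∞) = _ := ⟨_, ENNReal.coe_toNNReal hAX.ne⟩
  refine ⟨A, fun R hR => ?_⟩
  have h1 : (volume (centeredCube n R))⁻¹ * ρ ((centeredCube n R).indicator 1) *
      associateNorm ρ ((centeredCube n R).indicator 1) ≤ A := by
    rw [hA]
    exact le_iSup₂_of_le (WithLp.toLp 2 fun _ => -R) (2 * R)
      (le_iSup_of_le (by positivity) le_rfl)
  have hv : volume (centeredCube n R) = ENNReal.ofReal (2 * R) ^ n := volume_axisCube _ _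
  have h0 : volume (centeredCube n R) ≠ 0 := volume_axisCube_ne_zero _ (by positivity)
  have ht : volume (centeredCube n R) ≠ ∞ := volume_axisCube_ne_top _ _
  rw [mul_assoc] at h1
  rw [← hv, mul_comm (A : ℝ≥0∞)]
  calc _ = volume (centeredCube n R) * ((volume (centeredCube n R))⁻¹ *
        (ρ ((centeredCube n R).indicator 1) *
          associateNorm ρ ((centeredCube n R).indicator 1))) := by
        rw [← mul_assoc, ENNReal.mul_inv_cancel h0 ht, one_mul]
    _ ≤ _ := by gcongr

theorem ball_lt_top (h : IsLatticeNorm ρ) {R : ℝ} (hR : 0 < R) :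
    ρ ((Metric.closedBall (0 : Rn n) R).indicator 1) < ∞ :=
  (h.mono _ _ (aemeasurable_indicator_one (measurableSet_axisCube _ _))
    (aemeasurable_indicator_one Metric.isClosed_closedBall.measurableSet)
    (Eventually.of_forall (Set.indicator_le_indicator_of_subset
      (closedBall_subset_centeredCube R) fun _ => zero_le))).trans_lt
    (h.cube_lt_top _ _ (by positivity))

theorem ball_ne_zero (h : IsLatticeNorm ρ) {R : ℝ} (hR : 0 < R) :
    ρ ((Metric.closedBall (0 : Rn n) R).indicator 1) ≠ 0 := by
  intro h0
  have h1 := h.ae_eq_zero _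
    (aemeasurable_indicator_one Metric.isClosed_closedBall.measurableSet) h0
  have h2 : volume (Metric.closedBall (0 : Rn n) R) = 0 := by
    refine measure_mono_null (fun x hx => ?_) h1
    simp only [Set.mem_compl_iff, Set.mem_ofPred_eq]
    rw [Set.indicator_of_mem hx]
    exact one_ne_zero
  exact (Metric.measure_closedBall_pos volume (0 : Rn n) hR).ne' h2

/-- For R ≥ 1 the associate norm of the cube of half-side R is at least that of the unit one, a
positive constant; dividing the `AXCondition` by it leaves the volume. -/
theorem exists_ball_le (h : IsLatticeNorm ρ) (hAX : AXCondition ρ) :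
    ∃ C : ℝ≥0, ∀ R : ℝ, 1 ≤ R →
      ρ ((Metric.closedBall (0 : Rn n) R).indicator 1) ≤ C * ENNReal.ofReal R ^ n := by
  obtain ⟨A, hA⟩ := exists_mul_associateNorm_le hAX
  set c := associateNorm ρ ((centeredCube n 1).indicator 1) with hc
  -- Hölder for the indicator against itself bounds the positive volume of the cube by a multiple of
  -- c.
  have hc0 : c ≠ 0 := by
    intro h0
    have h1 := h.lintegral_mul_le (g := (centeredCube n 1).indicator 1)
      (aemeasurable_indicator_one (measurableSet_axisCube _ _))
      (h.cube_lt_top (WithLp.toLp 2 fun _ => -1) (2 * 1) (by norm_num)).ne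
    rw [← centeredCube, ← hc, h0, mul_zero] at h1
    have h2 : (fun x => (centeredCube n 1).indicator (1 : Rn n → ℝ≥0∞) x *
        (centeredCube n 1).indicator 1 x) = (centeredCube n 1).indicator 1 := by
      ext x
      by_cases hx : x ∈ centeredCube n 1 <;> simp [hx]
    rw [h2, lintegral_indicator_one (measurableSet_centeredCube n 1)] at h1
    exact volume_axisCube_ne_zero (WithLp.toLp 2 fun _ : Fin n => (-1 : ℝ)) (l := 2 * 1)
      (by norm_num) (le_zero_iff.1 h1)
  have hfin : A * 2 ^ n / c ≠ ∞ :=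
    ENNReal.div_ne_top (ENNReal.mul_ne_top ENNReal.coe_ne_top (by finiteness)) hc0
  obtain ⟨C, hC⟩ : ∃ C : ℝ≥0, (C : ℝ≥0∞) = A * 2 ^ n / c := ⟨_, ENNReal.coe_toNNReal hfin⟩
  refine ⟨C, fun R hR => ?_⟩
  have hR0 : 0 < R := by linarith
  have h1 : ρ ((Metric.closedBall (0 : Rn n) R).indicator 1) * c ≤
      A * ENNReal.ofReal (2 * R) ^ n := by
    refine le_trans ?_ (hA R hR0)
    refine mul_le_mul' ?_ ?_
    · exact h.mono _ _ (aemeasurable_indicator_one (measurableSet_axisCube _ _))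
        (aemeasurable_indicator_one Metric.isClosed_closedBall.measurableSet)
        (Eventually.of_forall (Set.indicator_le_indicator_of_subset
          (closedBall_subset_centeredCube R) fun _ => zero_le))
    · exact associateNorm_mono ρ (Set.indicator_le_indicator_of_subset
        (centeredCube_mono hR) fun _ => zero_le)
  have h2 : A * ENNReal.ofReal (2 * R) ^ n ≠ ∞ :=
    ENNReal.mul_ne_top ENNReal.coe_ne_top (by finiteness)
  rw [← ENNReal.le_div_iff_mul_le (Or.inl hc0) (Or.inr h2)] at h1
  refine h1.trans (le_of_eq ?_)
  rw [hC, ENNReal.ofReal_mul (by norm_num), mul_pow, ENNReal.ofReal_ofNat, ← mul_assoc,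
    ENNReal.mul_div_right_comm]

/-- Otherwise the norm of the ball of radius τ^k S would exceed a positive multiple of t^k for every
k, against the bound C (τ^k S)^n, since t > τ^n. -/
theorem exists_ball_dilate_le (h : IsLatticeNorm ρ) (hAX : AXCondition ρ) {τ : ℝ} (hτ : 1 < τ)
    {t : ℝ} (ht : τ ^ n < t) (R₀ : ℝ) :
    ∃ R, R₀ ≤ R ∧ 1 ≤ R ∧ ρ ((Metric.closedBall (0 : Rn n) (τ * R)).indicator 1) ≤
      ENNReal.ofReal t * ρ ((Metric.closedBall (0 : Rn n) R).indicator 1) := by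
  by_contra! hcon
  obtain ⟨C, hC⟩ := h.exists_ball_le hAX
  set V : ℝ → ℝ≥0∞ := fun R => ρ ((Metric.closedBall (0 : Rn n) R).indicator 1) with hV
  set S := max R₀ 1 with hS
  have hS1 : 1 ≤ S := le_max_right _ _
  have hτn : 0 < τ ^ n := by positivity
  have ht0 : 0 < t := hτn.trans ht
  have hpow : ∀ k : ℕ, S ≤ τ ^ k * S := fun k =>
    le_mul_of_one_le_left (by linarith) (one_le_pow₀ hτ.le)
  have hiter : ∀ k : ℕ, ENNReal.ofReal t ^ k * V S ≤ V (τ ^ k * S) := by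
    intro k
    induction k with
    | zero => simp
    | succ k ih =>
      have h1 := hcon (τ ^ k * S) ((le_max_left _ _).trans (hpow k)) (hS1.trans (hpow k))
      calc ENNReal.ofReal t ^ (k + 1) * V S
          = ENNReal.ofReal t * (ENNReal.ofReal t ^ k * V S) := by ring
        _ ≤ ENNReal.ofReal t * V (τ ^ k * S) := by gcongr
        _ ≤ V (τ * (τ ^ k * S)) := h1.le
        _ = V (τ ^ (k + 1) * S) := by congr 1; ring
  have hVS : V S ≠ 0 := h.ball_ne_zero (by linarith)
  have hVS' : V S ≠ ∞ := (h.ball_lt_top (by linarith)).ne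
  have hv : 0 < (V S).toReal := ENNReal.toReal_pos hVS hVS'
  have hreal : ∀ k : ℕ, (t / τ ^ n) ^ k ≤ C * S ^ n / (V S).toReal := fun k => by
    have h1 := (hiter k).trans (hC _ (hS1.trans (hpow k)))
    have h2 := ENNReal.toReal_mono
      (ENNReal.mul_ne_top ENNReal.coe_ne_top (ENNReal.pow_ne_top ENNReal.ofReal_ne_top)) h1
    rw [ENNReal.toReal_mul, ENNReal.toReal_pow, ENNReal.toReal_mul, ENNReal.toReal_pow,
      ENNReal.toReal_ofReal ht0.le, ENNReal.toReal_ofReal (by positivity),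
      ENNReal.coe_toReal] at h2
    rw [le_div_iff₀ hv, div_pow, div_mul_eq_mul_div, div_le_iff₀ (by positivity)]
    calc _ ≤ _ := h2
      _ = _ := by rw [mul_pow]; ring
  have hgt : 1 < t / τ ^ n := (one_lt_div hτn).2 ht
  obtain ⟨k, hk⟩ := pow_unbounded_of_one_lt (C * S ^ n / (V S).toReal) hgt
  exact absurd (hreal k) (not_le.2 hk)

end IsLatticeNorm

/-! ### Convolution of Schwartz functions. -/

namespace SchwartzMap

variable {n : ℕ}

/-- The convolution of Schwartz functions. -/
noncomputable def conv (g u : 𝓢(Rn n, ℂ)) : 𝓢(Rn n, ℂ) :=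
  convolution (ContinuousLinearMap.mul ℂ ℂ) g u

theorem conv_apply (g u : 𝓢(Rn n, ℂ)) (x : Rn n) : conv g u x = ∫ t, g t * u (x - t) := by
  rw [conv, convolution_apply]
  rfl

theorem fourier_conv (g u : 𝓢(Rn n, ℂ)) : 𝓕 (conv g u) = prod (𝓕 g) (𝓕 u) :=
  fourier_convolution _ g u

theorem norm_conv_le (g u : 𝓢(Rn n, ℂ)) {U : ℝ} (hu : ∀ x, ‖u x‖ ≤ U) (x : Rn n) :
    ‖conv g u x‖ ≤ (∫ t, ‖g t‖) * U := by
  rw [conv_apply, ← integral_mul_const]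
  refine norm_integral_le_of_norm_le (g.integrable.norm.mul_const U)
    (Eventually.of_forall fun t => ?_)
  rw [norm_mul]
  exact mul_le_mul_of_nonneg_left (hu _) (norm_nonneg _)

theorem conv_eq_zero (g u : 𝓢(Rn n, ℂ)) {r R : ℝ} (hg : ∀ x, r < ‖x‖ → g x = 0)
    (hu : ∀ x, R < ‖x‖ → u x = 0) (x : Rn n) (hx : r + R < ‖x‖) : conv g u x = 0 := by
  rw [conv_apply]
  refine integral_eq_zero_of_ae (Eventually.of_forall fun t => ?_)
  rcases lt_or_ge r ‖t‖ with h | h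
  · simp [hg t h]
  · have : R < ‖x - t‖ := by linarith [norm_sub_norm_le x t]
    simp [hu _ this]

theorem prod_assoc (f g h : 𝓢(Rn n, ℂ)) : prod (prod f g) h = prod f (prod g h) := by
  ext x
  simp only [prod_apply, mul_assoc]

theorem prod_comm (f g : 𝓢(Rn n, ℂ)) : prod f g = prod g f := by
  ext x
  simp only [prod_apply, mul_comm]

theorem smul_prod (c : ℝ) (f g : 𝓢(Rn n, ℂ)) : prod (c • f) g = c • prod f g := by
  ext x
  simp only [prod_apply, smul_apply, smul_mul_assoc]

theorem prod_smul (c : ℝ) (f g : 𝓢(Rn n, ℂ)) : prod f (c • g) = c • prod f g := by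
  ext x
  simp only [prod_apply, smul_apply, mul_smul_comm]

theorem prod_trans (ξ : Rn n) (f g : 𝓢(Rn n, ℂ)) :
    prod (trans ξ f) (trans ξ g) = trans ξ (prod f g) := rfl

theorem prod_dil {c : ℝ} (hc : c ≠ 0) (f g : 𝓢(Rn n, ℂ)) :
    prod (dil c hc f) (dil c hc g) = dil c hc (prod f g) := rfl

end SchwartzMap

open SchwartzMap

/-! ### Bounded multipliers tested on compactly supported functions. -/

/-- The function `f` represents the functional `v ↦ ⟨a, 𝓕 u · 𝓕⁻ v⟩`. -/
structure IsMultiplierImage {n : ℕ} (a : 𝓢'(Rn n, ℂ)) (u : 𝓢(Rn n, ℂ)) (f : Rn n → ℂ) :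
    Prop where
  aestronglyMeasurable : AEStronglyMeasurable f volume
  integrable : ∀ v : 𝓢(Rn n, ℂ), Integrable (fun x => f x * v x) volume
  eq_integral : ∀ v : 𝓢(Rn n, ℂ), a (prod (𝓕 u) (𝓕⁻ v)) = ∫ x, f x * v x

/-- The multiplier with symbol `a` is bounded with norm at most `M` with respect to `ρ`. -/
def IsBoundedMultiplier {n : ℕ} (ρ : (Rn n → ℝ≥0∞) → ℝ≥0∞) (a : 𝓢'(Rn n, ℂ)) (M : ℝ≥0) : Prop :=
  ∀ u : 𝓢(Rn n, ℂ), ρ (fun x => ‖u x‖ₑ) < ∞ →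
    ∃ f, IsMultiplierImage a u f ∧ ρ (fun x => ‖f x‖ₑ) ≤ M * ρ (fun x => ‖u x‖ₑ)

section

variable {n : ℕ} {ρ : (Rn n → ℝ≥0∞) → ℝ≥0∞} {a : 𝓢'(Rn n, ℂ)} {M : ℝ≥0}

theorem enorm_le_mul_indicator {u : Rn n → ℂ} {U : ℝ≥0} (hu : ∀ x, ‖u x‖ ≤ U) {S : ℝ}
    (hus : ∀ x, S < ‖x‖ → u x = 0) (x : Rn n) :
    ‖u x‖ₑ ≤ U * (Metric.closedBall (0 : Rn n) S).indicator 1 x := by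
  by_cases hx : x ∈ Metric.closedBall (0 : Rn n) S
  · rw [Set.indicator_of_mem hx, Pi.one_apply, mul_one]
    exact enorm_le_coe.2 (hu x)
  · rw [hus x (by simpa using hx)]
    simp

theorem IsLatticeNorm.le_mul_ball (h : IsLatticeNorm ρ) {u : Rn n → ℂ}
    (hm : AEStronglyMeasurable u volume) {U : ℝ≥0} (hu : ∀ x, ‖u x‖ ≤ U) {S : ℝ}
    (hus : ∀ x, S < ‖x‖ → u x = 0) :
    ρ (fun x => ‖u x‖ₑ) ≤ U * ρ ((Metric.closedBall (0 : Rn n) S).indicator 1) := by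
  rw [← h.const_mul _ (aemeasurable_indicator_one Metric.isClosed_closedBall.measurableSet)]
  exact h.mono _ _ ((aemeasurable_indicator_one
    Metric.isClosed_closedBall.measurableSet).const_mul _) hm.enorm
    (Eventually.of_forall (enorm_le_mul_indicator hu hus))

/-- Hölder pairs the image of u with v on a cube containing both supports. The norm of the cube and
its associate norm appear together, and the `AXCondition` replaces their product by the volume. -/
theorem IsBoundedMultiplier.exists_norm_le (h : IsLatticeNorm ρ) (hAX : AXCondition ρ)
    (ha : IsBoundedMultiplier ρ a M) :
    ∃ A : ℝ, 0 ≤ A ∧ ∀ (u v : 𝓢(Rn n, ℂ)) (U W : ℝ≥0) (S : ℝ), 0 < S →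
      (∀ x, ‖u x‖ ≤ U) → (∀ x, S < ‖x‖ → u x = 0) →
      (∀ x, ‖v x‖ ≤ W) → (∀ x, S < ‖x‖ → v x = 0) →
      ‖a (prod (𝓕 u) (𝓕⁻ v))‖ ≤ A * U * W * S ^ n := by
  obtain ⟨A, hA⟩ := IsLatticeNorm.exists_mul_associateNorm_le hAX
  refine ⟨M * A * 2 ^ n, by positivity, fun u v U W S hS hu hus hv hvs => ?_⟩
  have hB : ∀ x, (Metric.closedBall (0 : Rn n) S).indicator (1 : Rn n → ℝ≥0∞) x ≤
      (centeredCube n S).indicator 1 x :=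
    Set.indicator_le_indicator_of_subset (closedBall_subset_centeredCube S) fun _ => zero_le
  have hBm := aemeasurable_indicator_one
    (Metric.isClosed_closedBall (x := (0 : Rn n)) (ε := S)).measurableSet
  have hρB := h.mono _ _ (aemeasurable_indicator_one (measurableSet_centeredCube n S)) hBm
    (Eventually.of_forall hB)
  have hρu := (h.le_mul_ball u.continuous.aestronglyMeasurable hu hus)
  obtain ⟨f, hf, hfρ⟩ := ha u (hρu.trans_lt
    (ENNReal.mul_lt_top ENNReal.coe_lt_top (h.ball_lt_top hS)))
  have hρf := hfρ.trans (mul_le_mul_right hρu (M : ℝ≥0∞))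
  have hρf_fin : ρ (fun x => ‖f x‖ₑ) ≠ ∞ := (hρf.trans_lt (ENNReal.mul_lt_top ENNReal.coe_lt_top
    (ENNReal.mul_lt_top ENNReal.coe_lt_top (h.ball_lt_top hS)))).ne
  have key : ‖a (prod (𝓕 u) (𝓕⁻ v))‖ₑ ≤
      ENNReal.ofReal (M * A * 2 ^ n * U * W * S ^ n) := by
    rw [hf.eq_integral]
    calc ‖∫ x, f x * v x‖ₑ ≤ ∫⁻ x, ‖f x * v x‖ₑ := enorm_integral_le_lintegral_enorm _
      _ ≤ ∫⁻ x, W * (‖f x‖ₑ * (centeredCube n S).indicator 1 x) := by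
          refine lintegral_mono fun x => ?_
          rw [enorm_mul, mul_left_comm]
          exact mul_le_mul_right ((enorm_le_mul_indicator hv hvs x).trans
            (mul_le_mul_right (hB x) _)) _
      _ = W * ∫⁻ x, ‖f x‖ₑ * (centeredCube n S).indicator 1 x :=
          lintegral_const_mul' _ _ ENNReal.coe_ne_top
      _ ≤ W * (ρ (fun x => ‖f x‖ₑ) * associateNorm ρ ((centeredCube n S).indicator 1)) := by
          gcongr
          exact h.lintegral_mul_le hf.aestronglyMeasurable.enorm hρf_fin
      _ ≤ W * ((M * (U * ρ ((centeredCube n S).indicator 1))) *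
            associateNorm ρ ((centeredCube n S).indicator 1)) := by
          gcongr
          exact hρf.trans (by gcongr)
      _ = M * U * W * (ρ ((centeredCube n S).indicator 1) *
            associateNorm ρ ((centeredCube n S).indicator 1)) := by ring
      _ ≤ M * U * W * (A * ENNReal.ofReal (2 * S) ^ n) := by
          exact mul_le_mul_right (hA S hS) _
      _ = _ := by
          rw [← ENNReal.ofReal_pow (by positivity)]
          simp only [← ENNReal.ofReal_coe_nnreal]
          rw [← ENNReal.ofReal_mul (by positivity), ← ENNReal.ofReal_mul (by positivity),
            ← ENNReal.ofReal_mul (by positivity), ← ENNReal.ofReal_mul (by positivity)]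
          congr 1
          ring
  rw [← ofReal_norm, ENNReal.ofReal_le_ofReal_iff (by positivity)] at key
  exact key

/-- Since f · 𝓕K is integrable, its Fourier transform at ξ is the value of a on 𝓕g times the
translate of K by ξ. The multiplication formula then moves the average over translates with weight ψ
through a. The factor 𝓕g is there to supply the function f that justifies this interchange. -/
theorem IsMultiplierImage.norm_le {g K : 𝓢(Rn n, ℂ)} {f : Rn n → ℂ}
    (hf : IsMultiplierImage a g f) {B : ℝ}
    (hB : ∀ ξ, ‖a (prod (𝓕 g) (trans ξ K))‖ ≤ B) (ψ : 𝓢(Rn n, ℂ)) :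
    ‖a (prod (𝓕 g) (𝓕⁻ (prod (𝓕 ψ) (𝓕 K))))‖ ≤ B * ∫ x, ‖ψ x‖ := by
  have hint : Integrable (fun x => f x * 𝓕 K x) volume := hf.integrable _
  have hF : ∀ ξ, 𝓕 (fun x => f x * 𝓕 K x) ξ = a (prod (𝓕 g) (trans ξ K)) := fun ξ => by
    have h1 := hf.eq_integral (𝓕 (trans ξ K))
    rw [FourierTransform.fourierInv_fourier_eq] at h1
    rw [h1, Real.fourier_eq]
    refine integral_congr_ae (Eventually.of_forall fun x => ?_)
    simp only
    rw [fourier_trans, real_inner_comm, mul_smul_comm]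
  have h2 : a (prod (𝓕 g) (𝓕⁻ (prod (𝓕 ψ) (𝓕 K)))) =
      ∫ ξ, ψ ξ * a (prod (𝓕 g) (trans ξ K)) := by
    rw [hf.eq_integral]
    have h3 := VectorFourier.integral_bilin_fourierIntegral_eq_flip (ContinuousLinearMap.mul ℂ ℂ)
      (L := innerₗ (Rn n)) Real.continuous_fourierChar continuous_inner (ψ.integrable (μ := volume))
      hint
    rw [flip_innerₗ] at h3
    calc ∫ x, f x * prod (𝓕 ψ) (𝓕 K) x = ∫ x, 𝓕 ψ x * (f x * 𝓕 K x) := by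
          refine integral_congr_ae (Eventually.of_forall fun x => ?_)
          simp only [prod_apply]
          ring
      _ = ∫ ξ, ψ ξ * 𝓕 (fun x => f x * 𝓕 K x) ξ := h3
      _ = _ := by simp_rw [hF]
  rw [h2, mul_comm, ← integral_mul_const]
  refine norm_integral_le_of_norm_le (ψ.integrable.norm.mul_const B)
    (Eventually.of_forall fun ξ => ?_)
  rw [norm_mul]
  exact mul_le_mul_of_nonneg_left (hB ξ) (norm_nonneg _)

end

theorem TemperedDistribution.map_smul_complex {n : ℕ} (a : 𝓢'(Rn n, ℂ)) (c : ℂ)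
    (g : 𝓢(Rn n, ℂ)) : a (c • g) = c • a g :=
  a.toLinearMap.map_smul c g

theorem TemperedDistribution.map_real_smul {n : ℕ} (a : 𝓢'(Rn n, ℂ)) (c : ℝ)
    (g : 𝓢(Rn n, ℂ)) : a (c • g) = c • a g :=
  (a.toLinearMap.restrictScalars ℝ).map_smul c g

/-! ### Bump functions, and the L^1 bound for the symbol. -/

/-- The Schwartz function given by a smooth bump function. -/
noncomputable def ContDiffBump.toSchwartzMap {n : ℕ} (φ : ContDiffBump (0 : Rn n)) : 𝓢(Rn n, ℂ) :=
  HasCompactSupport.toSchwartzMap (f := fun x => (φ x : ℂ))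
    (φ.hasCompactSupport.comp_left (g := Complex.ofReal) rfl)
    (Complex.ofRealCLM.contDiff.comp φ.contDiff)

section

variable {n : ℕ}

theorem ContDiffBump.toSchwartzMap_apply (φ : ContDiffBump (0 : Rn n)) (x : Rn n) :
    φ.toSchwartzMap x = (φ x : ℂ) := rfl

theorem ContDiffBump.norm_toSchwartzMap_le_one (φ : ContDiffBump (0 : Rn n)) (x : Rn n) :
    ‖φ.toSchwartzMap x‖ ≤ 1 := by
  rw [toSchwartzMap_apply, Complex.norm_real, Real.norm_of_nonneg φ.nonneg]
  exact φ.le_one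

theorem ContDiffBump.toSchwartzMap_eq_zero (φ : ContDiffBump (0 : Rn n)) {x : Rn n}
    (hx : φ.rOut < ‖x‖) : φ.toSchwartzMap x = 0 := by
  rw [toSchwartzMap_apply, φ.zero_of_le_dist (by simpa using hx.le), Complex.ofReal_zero]

theorem ContDiffBump.dil_toSchwartzMap_eq_zero (φ : ContDiffBump (0 : Rn n)) {R : ℝ} (hR : 0 < R)
    {x : Rn n} (hx : R * φ.rOut < ‖x‖) :
    dil R⁻¹ (inv_ne_zero hR.ne') φ.toSchwartzMap x = 0 := by
  rw [dil_apply]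
  refine φ.toSchwartzMap_eq_zero ?_
  rw [norm_smul, norm_inv, Real.norm_of_nonneg hR.le, ← div_eq_inv_mul, lt_div_iff₀ hR, mul_comm]
  exact hx

theorem ContDiffBump.fourier_toSchwartzMap_zero_ne_zero (φ : ContDiffBump (0 : Rn n)) :
    𝓕 φ.toSchwartzMap 0 ≠ 0 := by
  rw [fourier_coe, Real.fourier_eq]
  simp only [inner_zero_right, neg_zero, AddChar.map_zero_eq_one, one_smul, toSchwartzMap_apply]
  rw [integral_complex_ofReal]
  exact_mod_cast (φ.integral_pos (μ := volume)).ne'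

/-- The value at 0 is the integral of the product, which the multiplication formula turns into the
integral of φ². -/
theorem ContDiffBump.fourier_prod_fourier_zero_ne_zero (φ : ContDiffBump (0 : Rn n)) :
    𝓕 (prod (𝓕 φ.toSchwartzMap) (𝓕⁻ φ.toSchwartzMap)) 0 ≠ 0 := by
  rw [fourier_coe, Real.fourier_eq]
  simp only [inner_zero_right, neg_zero, AddChar.map_zero_eq_one, one_smul, prod_apply]
  rw [integral_fourier_mul_eq, FourierTransform.fourier_fourierInv_eq]
  simp only [toSchwartzMap_apply, ← Complex.ofReal_mul]
  rw [integral_complex_ofReal]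
  have hpos : 0 < ∫ x, φ x * φ x := by
    have hc : Continuous fun x => φ x * φ x := φ.continuous.mul φ.continuous
    refine hc.integral_pos_of_hasCompactSupport_nonneg_nonzero
      φ.hasCompactSupport.mul_right (fun x => mul_self_nonneg _) (x := 0) ?_
    rw [φ.one_of_mem_closedBall (by simpa using φ.rIn_pos.le)]
    norm_num
  exact_mod_cast hpos.ne'

theorem integral_norm_dil_inv {ε : ℝ} (hε : 0 < ε) (φ : 𝓢(Rn n, ℂ)) :
    ∫ x, ‖dil ε⁻¹ (inv_ne_zero hε.ne') φ x‖ = ε ^ n * ∫ x, ‖φ x‖ := by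
  have := Measure.integral_comp_smul (volume : Measure (Rn n)) (fun x => ‖φ x‖) ε⁻¹
  rw [finrank_euclideanSpace_fin] at this
  simp only [dil_apply]
  rw [this, smul_eq_mul, inv_pow, inv_inv, abs_of_pos (by positivity)]

theorem fourier_dil_inv {R : ℝ} (hR : 0 < R) (u : 𝓢(Rn n, ℂ)) :
    𝓕 (dil R⁻¹ (inv_ne_zero hR.ne') u) = R ^ n • dil R hR.ne' (𝓕 u) := by
  rw [fourier_dil, abs_of_pos (inv_pos.2 hR), inv_pow, inv_inv]
  congr 1
  ext x
  simp only [dil_apply, inv_inv]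

theorem fourierInv_dil_inv {R : ℝ} (hR : 0 < R) (u : 𝓢(Rn n, ℂ)) :
    𝓕⁻ (dil R⁻¹ (inv_ne_zero hR.ne') u) = R ^ n • dil R hR.ne' (𝓕⁻ u) := by
  rw [fourierInv_dil, abs_of_pos (inv_pos.2 hR), inv_pow, inv_inv]
  congr 1
  ext x
  simp only [dil_apply, inv_inv]

variable {ρ : (Rn n → ℝ≥0∞) → ℝ≥0∞} {a : 𝓢'(Rn n, ℂ)} {M : ℝ≥0}

/-- Translating the kernel by ξ amounts to modulating the two bumps of width R, which changes
neither moduli nor supports, so the bound is uniform in ξ. The factor ε^n is the L^1 norm of the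
narrow bump, and R^n comes from the supports. -/
theorem IsBoundedMultiplier.exists_norm_trans_le (h : IsLatticeNorm ρ) (hAX : AXCondition ρ)
    (ha : IsBoundedMultiplier ρ a M) (φ : ContDiffBump (0 : Rn n)) :
    ∃ A : ℝ, 0 ≤ A ∧ ∀ (ε R : ℝ) (hε : 0 < ε) (hR : 0 < R), ε ≤ R → ∀ ξ : Rn n,
      ‖a (prod (𝓕 (dil ε⁻¹ (inv_ne_zero hε.ne') φ.toSchwartzMap))
        (trans ξ (prod (𝓕 (dil R⁻¹ (inv_ne_zero hR.ne') φ.toSchwartzMap))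
          (𝓕⁻ (dil R⁻¹ (inv_ne_zero hR.ne') φ.toSchwartzMap)))))‖ ≤ A * ε ^ n * R ^ n := by
  obtain ⟨A, hA0, hA⟩ := ha.exists_norm_le h hAX
  have hout := φ.rOut_pos
  have hm0 : 0 ≤ ∫ x, ‖φ.toSchwartzMap x‖ := integral_nonneg fun _ => norm_nonneg _
  refine ⟨A * (∫ x, ‖φ.toSchwartzMap x‖) * (2 * φ.rOut) ^ n, by positivity,
    fun ε R hε hR hεR ξ => ?_⟩
  set φR := dil R⁻¹ (inv_ne_zero hR.ne') φ.toSchwartzMap with hφR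
  set g := dil ε⁻¹ (inv_ne_zero hε.ne') φ.toSchwartzMap with hg
  set u : 𝓢(Rn n, ℂ) := 𝓕⁻ (SchwartzMap.trans ξ (𝓕 φR)) with hu
  set v : 𝓢(Rn n, ℂ) := 𝓕 (SchwartzMap.trans ξ (𝓕⁻ φR)) with hv
  have hun : ∀ x, ‖u x‖ = ‖φR x‖ := fun x => by
    rw [hu, norm_fourierInv_trans, FourierTransform.fourierInv_fourier_eq]
  have hvn : ∀ x, ‖v x‖ = ‖φR x‖ := fun x => by
    rw [hv, norm_fourier_trans, FourierTransform.fourier_fourierInv_eq]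
  have hφ1 : ∀ x, ‖φR x‖ ≤ 1 := fun x => φ.norm_toSchwartzMap_le_one _
  have hφ0 : ∀ x, R * φ.rOut < ‖x‖ → ‖φR x‖ = 0 := fun x hx => by
    rw [hφR, φ.dil_toSchwartzMap_eq_zero hR hx, norm_zero]
  have hgn : ∫ x, ‖g x‖ = ε ^ n * ∫ x, ‖φ.toSchwartzMap x‖ := integral_norm_dil_inv hε _
  -- The regularizing factor 𝓕g is absorbed into u as a convolution, which keeps compact support.
  have hp : prod (𝓕 g) (trans ξ (prod (𝓕 φR) (𝓕⁻ φR))) = prod (𝓕 (conv g u)) (𝓕⁻ v) := by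
    rw [fourier_conv, hu, hv, FourierTransform.fourier_fourierInv_eq,
      FourierTransform.fourierInv_fourier_eq, SchwartzMap.prod_assoc, prod_trans]
  rw [hp]
  refine (hA (conv g u) v ⟨∫ x, ‖g x‖, integral_nonneg fun _ => norm_nonneg _⟩ 1
    ((ε + R) * φ.rOut) (by positivity) ?_ ?_ ?_ ?_).trans ?_
  · intro x
    have := norm_conv_le g u (U := 1) (fun x => (hun x).trans_le (hφ1 x)) x
    rwa [mul_one] at this
  · intro x hx
    refine conv_eq_zero g u (r := ε * φ.rOut) (R := R * φ.rOut)
      (fun x hx => φ.dil_toSchwartzMap_eq_zero hε hx)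
      (fun x hx => norm_eq_zero.1 ((hun x).trans (hφ0 x hx))) x ?_
    linarith
  · exact fun x => (hvn x).trans_le (hφ1 x)
  · intro x hx
    refine norm_eq_zero.1 ((hvn x).trans (hφ0 x ?_))
    nlinarith
  · change A * (∫ x, ‖g x‖) * 1 * ((ε + R) * φ.rOut) ^ n ≤ _
    rw [hgn]
    calc A * (ε ^ n * ∫ x, ‖φ.toSchwartzMap x‖) * 1 * ((ε + R) * φ.rOut) ^ n
        ≤ A * (ε ^ n * ∫ x, ‖φ.toSchwartzMap x‖) * 1 * ((R + R) * φ.rOut) ^ n := by gcongr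
      _ = _ := by
        rw [← two_mul, mul_pow, mul_pow, mul_pow]
        ring

/-- After rescaling, the factors ε^n and R^n cancel. Then ε → 0 removes the regularizing factor and
R → ∞ turns the kernel into a multiple of a point mass, leaving the nonzero constants θ₀ and κ. -/
theorem IsBoundedMultiplier.exists_norm_le_integral (h : IsLatticeNorm ρ) (hAX : AXCondition ρ)
    (ha : IsBoundedMultiplier ρ a M) :
    ∃ C : ℝ, 0 ≤ C ∧ ∀ ψ : 𝓢(Rn n, ℂ), ‖a ψ‖ ≤ C * ∫ x, ‖ψ x‖ := by
  let φ : ContDiffBump (0 : Rn n) := ⟨1, 2, one_pos, one_lt_two⟩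
  obtain ⟨A, hA0, hA⟩ := ha.exists_norm_trans_le h hAX φ
  set Φ := φ.toSchwartzMap with hΦ
  set K := prod (𝓕 Φ) (𝓕⁻ Φ) with hK
  set θ₀ := 𝓕 Φ 0 with hθ₀
  set κ := 𝓕 K 0 with hκ
  have hθ₀ne : θ₀ ≠ 0 := φ.fourier_toSchwartzMap_zero_ne_zero
  have hκne : κ ≠ 0 := φ.fourier_prod_fourier_zero_ne_zero
  set c : ℕ → ℝ := fun j => 1 / ((j : ℝ) + 1) with hc
  have hcpos : ∀ j, 0 < c j := fun j => by positivity
  have hcle : ∀ j, c j ≤ 1 := fun j => by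
    simp only [hc]
    rw [div_le_one (by positivity)]
    linarith [(Nat.cast_nonneg j : (0 : ℝ) ≤ j)]
  have hclim : Tendsto c atTop (𝓝 0) := tendsto_one_div_add_atTop_nhds_zero_nat
  have step1 : ∀ (R : ℝ) (hR : 1 ≤ R) (ε : ℝ) (hε : 0 < ε), ε ≤ 1 → ∀ ψ : 𝓢(Rn n, ℂ),
      ‖a (prod (dil ε hε.ne' (𝓕 Φ)) (𝓕⁻ (prod (𝓕 ψ)
        (dil R⁻¹ (inv_ne_zero (zero_lt_one.trans_le hR).ne') (𝓕 K)))))‖ ≤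
        A * ∫ x, ‖ψ x‖ := by
    intro R hR ε hε hε1 ψ
    have hR0 : 0 < R := by linarith
    have hfin : ρ (fun x => ‖dil ε⁻¹ (inv_ne_zero hε.ne') Φ x‖ₑ) < ∞ := by
      refine (h.le_mul_ball (u := dil ε⁻¹ (inv_ne_zero hε.ne') Φ)
        (SchwartzMap.continuous _).aestronglyMeasurable (U := 1)
        (fun x => φ.norm_toSchwartzMap_le_one _)
        (fun x hx => φ.dil_toSchwartzMap_eq_zero hε hx)).trans_lt ?_
      exact ENNReal.mul_lt_top ENNReal.coe_lt_top (h.ball_lt_top (mul_pos hε φ.rOut_pos))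
    obtain ⟨f, hf, -⟩ := ha _ hfin
    have h1 := hf.norm_le (hA ε R hε hR0 (hε1.trans hR)) ψ
    have hKR : prod (𝓕 (dil R⁻¹ (inv_ne_zero hR0.ne') Φ))
        (𝓕⁻ (dil R⁻¹ (inv_ne_zero hR0.ne') Φ)) = (R ^ n * R ^ n) • dil R hR0.ne' K := by
      rw [fourier_dil_inv hR0, fourierInv_dil_inv hR0, smul_prod, prod_smul, prod_dil, smul_smul]
    have hFK : 𝓕 ((R ^ n * R ^ n) • dil R hR0.ne' K) =
        R ^ n • dil R⁻¹ (inv_ne_zero hR0.ne') (𝓕 K) := by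
      rw [FourierTransform.fourier_smul, fourier_dil, smul_smul, abs_of_pos hR0]
      congr 1
      field_simp
    rw [hKR, hFK, fourier_dil_inv hε, smul_prod, prod_smul, FourierTransform.fourierInv_smul,
      prod_smul, smul_smul, TemperedDistribution.map_real_smul, norm_smul,
      Real.norm_of_nonneg (by positivity)] at h1
    have hpos : 0 < ε ^ n * R ^ n := by positivity
    refine le_of_mul_le_mul_left (h1.trans (le_of_eq ?_)) hpos
    ring
  have step2 : ∀ (R : ℝ) (hR : 1 ≤ R) (ψ : 𝓢(Rn n, ℂ)),
      ‖θ₀‖ * ‖a (𝓕⁻ (prod (𝓕 ψ)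
        (dil R⁻¹ (inv_ne_zero (zero_lt_one.trans_le hR).ne') (𝓕 K))))‖ ≤
        A * ∫ x, ‖ψ x‖ := by
    intro R hR ψ
    have hlim := tendsto_prod_dil (𝓕 Φ) (𝓕⁻ (prod (𝓕 ψ)
      (dil R⁻¹ (inv_ne_zero (zero_lt_one.trans_le hR).ne') (𝓕 K)))) (fun j => (hcpos j).ne') hclim
    have hcont : Continuous fun w : 𝓢(Rn n, ℂ) => ‖a w‖ := a.continuous.norm
    have h2 := (hcont.tendsto _).comp hlim
    rw [TemperedDistribution.map_smul_complex, norm_smul] at h2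
    exact le_of_tendsto h2 (Eventually.of_forall fun j => step1 R hR (c j) (hcpos j) (hcle j) ψ)
  have step3 : ∀ ψ : 𝓢(Rn n, ℂ), ‖θ₀‖ * (‖κ‖ * ‖a ψ‖) ≤ A * ∫ x, ‖ψ x‖ := by
    intro ψ
    have hlim := tendsto_prod_dil (𝓕 K) (𝓕 ψ) (fun j => (hcpos j).ne') hclim
    have hcont : Continuous fun w : 𝓢(Rn n, ℂ) => ‖θ₀‖ * ‖a (𝓕⁻ w)‖ :=
      continuous_const.mul
        (a.continuous.comp (FourierTransform.fourierInvCLM ℂ 𝓢(Rn n, ℂ)).continuous).norm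
    have h2 := (hcont.tendsto _).comp hlim
    rw [FourierTransform.fourierInv_smul, FourierTransform.fourierInv_fourier_eq,
      TemperedDistribution.map_smul_complex, norm_smul] at h2
    refine le_of_tendsto h2 (Eventually.of_forall fun j => ?_)
    -- The limit R → ∞ is taken along R = 1 / c j.
    have h3 := step2 (c j)⁻¹ ((one_le_inv₀ (hcpos j)).2 (hcle j)) ψ
    simp only [inv_inv] at h3
    simp only [Function.comp_apply]
    rwa [SchwartzMap.prod_comm]
  refine ⟨A / (‖θ₀‖ * ‖κ‖), by positivity, fun ψ => ?_⟩
  have hpos : 0 < ‖θ₀‖ * ‖κ‖ := mul_pos (norm_pos_iff.2 hθ₀ne) (norm_pos_iff.2 hκne)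
  rw [div_mul_eq_mul_div, le_div_iff₀ hpos]
  calc ‖a ψ‖ * (‖θ₀‖ * ‖κ‖) = ‖θ₀‖ * (‖κ‖ * ‖a ψ‖) := by ring
    _ ≤ _ := step3 ψ

end

/-! ### The sharp bound at Lebesgue points. -/

section

variable {n : ℕ}

theorem integral_scale_sub_eq (k : Rn n → ℝ) (ξ₀ : Rn n) {R : ℝ} (hR : 0 < R) :
    ∫ ξ, R ^ n * k (R • (ξ - ξ₀)) = ∫ y, k y := by
  rw [integral_const_mul, integral_sub_right_eq_self (fun ξ => k (R • ξ)),
    Measure.integral_comp_smul, finrank_euclideanSpace_fin, smul_eq_mul, abs_of_pos (by positivity),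
    ← mul_assoc, mul_inv_cancel₀ (by positivity), one_mul]

theorem integrable_scale_sub {k : Rn n → ℝ} (hk : Integrable k volume) (ξ₀ : Rn n) {R : ℝ}
    (hR : 0 < R) : Integrable (fun ξ => R ^ n * k (R • (ξ - ξ₀))) volume :=
  ((hk.comp_smul hR.ne').comp_sub_right ξ₀).const_mul _

/-- Rescalings of a Schwartz function are an approximate identity at every Lebesgue point of a
bounded function. -/
theorem tendsto_integral_norm_sub_mul_scale {b : Rn n → ℂ} (hb : AEStronglyMeasurable b volume)
    {C : ℝ} (hbC : ∀ᵐ x, ‖b x‖ ≤ C) {ξ₀ : Rn n} (hξC : ‖b ξ₀‖ ≤ C)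
    (hξ : Tendsto (fun r => ⨍ y in Metric.closedBall ξ₀ r, ‖b y - b ξ₀‖) (𝓝[>] 0) (𝓝 0))
    (κ : 𝓢(Rn n, ℂ)) :
    Tendsto (fun R : ℝ => ∫ ξ, ‖b ξ - b ξ₀‖ * (R ^ n * ‖κ (R • (ξ - ξ₀))‖)) atTop (𝓝 0) := by
  have hC : 0 ≤ C := (norm_nonneg _).trans hξC
  set k : ℕ → Rn n → ℝ := fun N =>
    (Metric.closedBall (0 : Rn n) (N + 1))ᶜ.indicator fun y => ‖κ y‖ with hk
  have hmeasc : ∀ N : ℕ, MeasurableSet (Metric.closedBall (0 : Rn n) ((N : ℝ) + 1))ᶜ := fun N =>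
    Metric.isClosed_closedBall.measurableSet.compl
  have hkint : ∀ N, Integrable (k N) volume := fun N => κ.integrable.norm.indicator (hmeasc N)
  have htail : Tendsto (fun N => ∫ y, k N y) atTop (𝓝 0) := by
    rw [← integral_zero (Rn n) ℝ (μ := volume)]
    refine tendsto_integral_of_dominated_convergence (fun y => ‖κ y‖)
      (fun N => (hkint N).aestronglyMeasurable) κ.integrable.norm
      (fun N => Eventually.of_forall fun y => ?_) (Eventually.of_forall fun y => ?_)
    · rw [Real.norm_of_nonneg (Set.indicator_nonneg (fun _ _ => norm_nonneg _) _)]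
      exact Set.indicator_le_self' (fun _ _ => norm_nonneg _) _
    · refine tendsto_const_nhds.congr' ?_
      filter_upwards [eventually_ge_atTop ⌈‖y‖⌉₊] with N hN
      have h1 : ‖y‖ ≤ N := Nat.ceil_le.1 hN
      rw [hk]
      simp only
      rw [Set.indicator_of_notMem]
      simp only [Set.mem_compl_iff, not_not, Metric.mem_closedBall, dist_zero_right]
      linarith
  set S := SchwartzMap.seminorm ℝ 0 0 κ with hS
  have hS0 : 0 ≤ S := by positivity
  have hκS : ∀ y, ‖κ y‖ ≤ S := κ.norm_le_seminorm ℝ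
  set w := (volume (Metric.closedBall (0 : Rn n) 1)).toReal with hw
  -- Inside the ball of radius (N + 1)/R the kernel is at most S R^n, which leaves a ball average.
  -- Outside, the bound 2C on the oscillation leaves the tail of κ. Later N is fixed first to make
  -- the tail small, and then R → ∞.
  have hmain : ∀ (N : ℕ) (R : ℝ), 0 < R →
      ∫ ξ, ‖b ξ - b ξ₀‖ * (R ^ n * ‖κ (R • (ξ - ξ₀))‖) ≤
        S * ((N + 1 : ℝ) ^ n * w) * (⨍ y in Metric.closedBall ξ₀ ((N + 1) / R), ‖b y - b ξ₀‖) +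
          2 * C * ∫ y, k N y := by
    intro N R hR
    have hN : (0 : ℝ) < N + 1 := by positivity
    set B := Metric.closedBall ξ₀ ((N + 1) / R) with hB
    have hBm : MeasurableSet B := Metric.isClosed_closedBall.measurableSet
    have hBfin : volume B ≠ ∞ := measure_closedBall_lt_top.ne
    have hdiff : ∀ᵐ ξ, ‖b ξ - b ξ₀‖ ≤ 2 * C := by
      filter_upwards [hbC] with ξ h
      linarith [norm_sub_le (b ξ) (b ξ₀)]
    have hbm : AEStronglyMeasurable (fun ξ => ‖b ξ - b ξ₀‖) volume :=
      (hb.sub aestronglyMeasurable_const).norm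
    have hint1 : IntegrableOn (fun ξ => ‖b ξ - b ξ₀‖) B volume := by
      refine Measure.integrableOn_of_bounded (M := 2 * C) hBfin hbm
        (ae_restrict_of_ae ?_)
      filter_upwards [hdiff] with ξ h
      rwa [norm_norm]
    have hvol : (volume B).toReal = ((N + 1) / R) ^ n * w := by
      rw [hB, Measure.addHaar_closedBall' _ _ (by positivity), finrank_euclideanSpace_fin,
        ENNReal.toReal_mul, ENNReal.toReal_ofReal (by positivity)]
    have hset : ∫ ξ in B, ‖b ξ - b ξ₀‖ =
        ((N + 1) / R) ^ n * w * ⨍ ξ in B, ‖b ξ - b ξ₀‖ := by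
      have h0 : (volume B).toReal ≠ 0 :=
        (ENNReal.toReal_pos (Metric.measure_closedBall_pos volume ξ₀ (by positivity)).ne'
          hBfin).ne'
      rw [setAverage_eq, smul_eq_mul, Measure.real, ← hvol, ← mul_assoc, mul_inv_cancel₀ h0,
        one_mul]
    have hI1 : Integrable (fun ξ => S * R ^ n * B.indicator (fun ξ => ‖b ξ - b ξ₀‖) ξ) volume :=
      (hint1.integrable_indicator hBm).const_mul _
    have hI2 : Integrable (fun ξ => 2 * C * (R ^ n * k N (R • (ξ - ξ₀)))) volume :=
      (integrable_scale_sub (hkint N) ξ₀ hR).const_mul _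
    calc ∫ ξ, ‖b ξ - b ξ₀‖ * (R ^ n * ‖κ (R • (ξ - ξ₀))‖)
        ≤ ∫ ξ, (S * R ^ n * B.indicator (fun ξ => ‖b ξ - b ξ₀‖) ξ +
            2 * C * (R ^ n * k N (R • (ξ - ξ₀)))) := by
          refine integral_mono_of_nonneg (Eventually.of_forall fun ξ => by positivity)
            (hI1.add hI2) ?_
          filter_upwards [hdiff] with ξ h
          by_cases hξB : ξ ∈ B
          · have h1 : 0 ≤ k N (R • (ξ - ξ₀)) := Set.indicator_nonneg (fun _ _ => norm_nonneg _) _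
            rw [Set.indicator_of_mem hξB]
            have h2 : 0 ≤ 2 * C * (R ^ n * k N (R • (ξ - ξ₀))) := by positivity
            calc ‖b ξ - b ξ₀‖ * (R ^ n * ‖κ (R • (ξ - ξ₀))‖)
                ≤ ‖b ξ - b ξ₀‖ * (R ^ n * S) := by
                  gcongr
                  exact hκS _
              _ = S * R ^ n * ‖b ξ - b ξ₀‖ := by ring
              _ ≤ _ := le_add_of_nonneg_right h2
          · have h1 : R • (ξ - ξ₀) ∈ (Metric.closedBall (0 : Rn n) ((N : ℝ) + 1))ᶜ := by
              have h2 : (N + 1) / R < ‖ξ - ξ₀‖ := by simpa [hB, dist_eq_norm] using hξB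
              simp only [Set.mem_compl_iff, Metric.mem_closedBall, dist_zero_right, not_le,
                norm_smul, Real.norm_of_nonneg hR.le]
              rwa [div_lt_iff₀' hR] at h2
            rw [Set.indicator_of_notMem hξB, mul_zero, zero_add, hk]
            simp only
            rw [Set.indicator_of_mem h1]
            gcongr
      _ = _ := by
          rw [integral_add hI1 hI2, integral_const_mul, integral_const_mul,
            integral_indicator hBm, hset, integral_scale_sub_eq (k N) ξ₀ hR, div_pow]
          congr 1
          field_simp
  rw [Metric.tendsto_atTop]
  intro ε hε
  obtain ⟨N, hN⟩ := ((htail.const_mul (2 * C)).eventually_lt_const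
    (by rw [mul_zero]; exact half_pos hε)).exists
  have hr : Tendsto (fun R : ℝ => (N + 1 : ℝ) / R) atTop (𝓝[>] 0) := by
    refine tendsto_nhdsWithin_iff.2 ⟨tendsto_const_nhds.div_atTop tendsto_id, ?_⟩
    filter_upwards [eventually_gt_atTop 0] with R hR
    exact div_pos (by positivity) hR
  have h1 := ((hξ.comp hr).const_mul (S * ((N + 1 : ℝ) ^ n * w))).eventually_lt_const
    (u := ε / 2) (by rw [mul_zero]; exact half_pos hε)
  obtain ⟨R₀, hR₀⟩ := eventually_atTop.1 (h1.and (eventually_gt_atTop (0 : ℝ)))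
  refine ⟨R₀, fun R hR => ?_⟩
  obtain ⟨h2, h3⟩ := hR₀ R hR
  rw [Real.dist_eq, sub_zero, abs_of_nonneg (integral_nonneg fun ξ => by positivity)]
  have h4 := hmain N R h3
  simp only [Function.comp_apply] at h2
  linarith

variable {ρ : (Rn n → ℝ≥0∞) → ℝ≥0∞} {a : 𝓢'(Rn n, ℂ)} {M : ℝ≥0}

/-- The difference f - zu is the inverse Fourier transform of (b - z)𝓕u, so it is bounded by the L^1
norm of the latter. The argument runs by duality, using that 𝓕⁻ψ is bounded by ‖ψ‖₁. -/
theorem IsMultiplierImage.ae_norm_sub_le {b : Rn n → ℂ} (hb : IsGivenBy a b)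
    {u : 𝓢(Rn n, ℂ)} {f : Rn n → ℂ} (hf : IsMultiplierImage a u f)
    (z : ℂ) : ∀ᵐ x, ‖f x - z * u x‖ ≤ ∫ ξ, ‖b ξ - z‖ * ‖𝓕 u ξ‖ := by
  have hu : ∀ v : 𝓢(Rn n, ℂ), Integrable (fun x => z * u x * v x) volume := fun v => by
    simpa only [mul_assoc, prod_apply] using (prod u v).integrable.const_mul z
  have hbint : Integrable (fun ξ => (b ξ - z) * 𝓕 u ξ) volume := by
    simp only [sub_mul]
    exact (hb.integrable _).sub ((𝓕 u).integrable.const_mul z)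
  refine ae_norm_le_of_forall_schwartz (locallyIntegrable_of_forall_schwartz fun v => ?_)
    fun ψ => ?_
  · simp only [sub_mul]
    exact (hf.integrable v).sub (hu v)
  · have hψ : ∀ ξ, ‖𝓕⁻ ψ ξ‖ ≤ ∫ x, ‖ψ x‖ := fun ξ => by
      rw [fourierInv_coe, Real.fourierInv_eq]
      refine (norm_integral_le_integral_norm _).trans (le_of_eq ?_)
      simp_rw [Circle.norm_smul]
    have h1 : ∫ x, (f x - z * u x) * ψ x = ∫ ξ, (b ξ - z) * 𝓕 u ξ * 𝓕⁻ ψ ξ := by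
      simp only [sub_mul]
      have h2 : ∫ x, z * u x * ψ x = ∫ ξ, z * 𝓕 u ξ * 𝓕⁻ ψ ξ := by
        simp only [mul_assoc]
        rw [integral_const_mul, integral_const_mul, integral_fourier_mul_eq,
          FourierTransform.fourier_fourierInv_eq]
      have h3 := hb.integrable (prod (𝓕 u) (𝓕⁻ ψ))
      have h4 := hb.eq_integral (prod (𝓕 u) (𝓕⁻ ψ))
      simp only [prod_apply, ← mul_assoc] at h3 h4
      rw [integral_sub (hf.integrable ψ) (hu ψ), integral_sub h3, ← hf.eq_integral, h4, h2]
      simpa only [mul_assoc, prod_apply] using (prod (𝓕 u) (𝓕⁻ ψ)).integrable.const_mul z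
    rw [h1, ← integral_mul_const]
    refine norm_integral_le_of_norm_le ?_ (Eventually.of_forall fun ξ => ?_)
    · simpa only [norm_mul] using hbint.norm.mul_const _
    · rw [norm_mul, norm_mul]
      exact mul_le_mul_of_nonneg_left (hψ ξ) (by positivity)

theorem IsBoundedMultiplier.norm_le_of_lebesgue_point (h : IsLatticeNorm ρ) (hAX : AXCondition ρ)
    (ha : IsBoundedMultiplier ρ a M) {b : Rn n → ℂ} (hb : IsGivenBy a b) {C : ℝ}
    (hbC : ∀ᵐ x, ‖b x‖ ≤ C) {ξ₀ : Rn n} (hξC : ‖b ξ₀‖ ≤ C)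
    (hξ : Tendsto (fun r => ⨍ y in Metric.closedBall ξ₀ r, ‖b y - b ξ₀‖) (𝓝[>] 0) (𝓝 0))
    {τ t : ℝ} (hτ : 1 < τ) (ht : τ ^ n < t) : ‖b ξ₀‖ ≤ M * t := by
  -- Dilated by R, this bump is 1 on B(R) and vanishes outside B(τR), so only the ratio of the norms
  -- of these balls is lost.
  let φ : ContDiffBump (0 : Rn n) := ⟨1, τ, one_pos, hτ⟩
  set Φ := φ.toSchwartzMap with hΦ
  have ht0 : 0 < t := lt_trans (by positivity) ht
  refine le_of_forall_pos_le_add fun ε hε => ?_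
  have hlim := tendsto_integral_norm_sub_mul_scale hb.aestronglyMeasurable hbC hξC hξ (𝓕 Φ)
  obtain ⟨R₀, hR₀⟩ := eventually_atTop.1 (hlim.eventually_lt_const hε)
  obtain ⟨R, hR, hR1, hV⟩ := h.exists_ball_dilate_le hAX hτ ht R₀
  have hRpos : 0 < R := by linarith
  have hδ := hR₀ R hR
  set V := ρ ((Metric.closedBall (0 : Rn n) R).indicator 1) with hVdef
  have hV0 : V ≠ 0 := h.ball_ne_zero hRpos
  have hVfin : V ≠ ∞ := (h.ball_lt_top hRpos).ne
  set u : 𝓢(Rn n, ℂ) := 𝓕⁻ (SchwartzMap.trans ξ₀ (𝓕 (dil R⁻¹ (inv_ne_zero hRpos.ne') Φ))) with hu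
  have hun : ∀ x, ‖u x‖ = ‖dil R⁻¹ (inv_ne_zero hRpos.ne') Φ x‖ := fun x => by
    rw [hu, norm_fourierInv_trans, FourierTransform.fourierInv_fourier_eq]
  have hFu : ∀ ξ, ‖𝓕 u ξ‖ = R ^ n * ‖𝓕 Φ (R • (ξ - ξ₀))‖ := fun ξ => by
    rw [hu, FourierTransform.fourier_fourierInv_eq, compSubConstCLM_apply, fourier_dil_inv hRpos,
      smul_apply, dil_apply, norm_smul, Real.norm_of_nonneg (by positivity)]
  have hρu : ρ (fun x => ‖u x‖ₑ) ≤ ENNReal.ofReal t * V := by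
    have h1 := h.le_mul_ball u.continuous.aestronglyMeasurable (U := 1) (S := τ * R)
      (fun x => (hun x).trans_le (φ.norm_toSchwartzMap_le_one _))
      (fun x hx => norm_eq_zero.1 ((hun x).trans (norm_eq_zero.2
        (φ.dil_toSchwartzMap_eq_zero hRpos (by rwa [mul_comm] at hx)))))
    rw [ENNReal.coe_one, one_mul] at h1
    exact h1.trans hV
  obtain ⟨f, hf, hfρ⟩ := ha u (hρu.trans_lt (by finiteness))
  have hae := hf.ae_norm_sub_le hb (b ξ₀)
  simp only [hFu] at hae
  have hball := aemeasurable_indicator_one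
    (Metric.isClosed_closedBall (x := (0 : Rn n)) (ε := R)).measurableSet
  -- On B(R) one has |u| = 1, hence |b(ξ₀)| ≤ |f| + ε there. Taking norms and bounding that of f by
  -- M t V gives the estimate.
  have hkey : ENNReal.ofReal ‖b ξ₀‖ * V ≤
      (M * ENNReal.ofReal t + ENNReal.ofReal ε) * V := by
    calc ENNReal.ofReal ‖b ξ₀‖ * V
        = ρ (fun x => ((‖b ξ₀‖).toNNReal : ℝ≥0∞) *
            (Metric.closedBall (0 : Rn n) R).indicator 1 x) := (h.const_mul _ hball _).symm
      _ ≤ ρ (fun x => ‖f x‖ₑ + (ε.toNNReal : ℝ≥0∞) *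
            (Metric.closedBall (0 : Rn n) R).indicator 1 x) := by
          refine h.mono _ _ (hf.aestronglyMeasurable.enorm.add (hball.const_mul _))
            (hball.const_mul _) ?_
          filter_upwards [hae] with x hx
          by_cases hxB : x ∈ Metric.closedBall (0 : Rn n) R
          · have hux : ‖u x‖ = 1 := by
              rw [hun, dil_apply, hΦ, ContDiffBump.toSchwartzMap_apply, φ.one_of_mem_closedBall,
                Complex.ofReal_one, norm_one]
              have : ‖x‖ ≤ R := by simpa using hxB
              change R⁻¹ • x ∈ Metric.closedBall (0 : Rn n) 1
              rw [mem_closedBall_zero_iff, norm_smul, norm_inv, Real.norm_of_nonneg hRpos.le,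
                ← div_eq_inv_mul, div_le_one hRpos]
              exact this
            rw [Set.indicator_of_mem hxB, Pi.one_apply, mul_one, mul_one, ← ofReal_norm,
              ENNReal.ofNNReal_toNNReal, ENNReal.ofNNReal_toNNReal,
              ← ENNReal.ofReal_add (norm_nonneg _) hε.le]
            refine ENNReal.ofReal_le_ofReal ?_
            have h1 : ‖b ξ₀ * u x‖ = ‖b ξ₀‖ := by rw [norm_mul, hux, mul_one]
            have h2 := norm_sub_norm_le (b ξ₀ * u x) (f x)
            rw [norm_sub_rev] at h2
            linarith
          · rw [Set.indicator_of_notMem hxB, mul_zero, mul_zero]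
            exact zero_le
      _ ≤ ρ (fun x => ‖f x‖ₑ) + ρ (fun x => (ε.toNNReal : ℝ≥0∞) *
            (Metric.closedBall (0 : Rn n) R).indicator 1 x) :=
          h.add_le _ _ hf.aestronglyMeasurable.enorm (hball.const_mul _)
      _ ≤ M * (ENNReal.ofReal t * V) + ENNReal.ofReal ε * V := by
          rw [h.const_mul _ hball]
          exact add_le_add (hfρ.trans (mul_le_mul_right hρu _)) le_rfl
      _ = _ := by ring
  rw [ENNReal.mul_le_mul_iff_left hV0 hVfin] at hkey
  rw [← ENNReal.ofReal_coe_nnreal, ← ENNReal.ofReal_mul M.coe_nonneg,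
    ← ENNReal.ofReal_add (by positivity) hε.le, ENNReal.ofReal_le_ofReal_iff (by positivity)] at hkey
  exact hkey

theorem IsBoundedMultiplier.exists_isGivenBy (h : IsLatticeNorm ρ) (hAX : AXCondition ρ)
    (ha : IsBoundedMultiplier ρ a M) :
    ∃ b : Rn n → ℂ, IsGivenBy a b ∧ ∀ᵐ x, ‖b x‖ ≤ M := by
  obtain ⟨C, hC, haC⟩ := ha.exists_norm_le_integral h hAX
  obtain ⟨b, hb, hbC⟩ := exists_bounded_of_forall_schwartz a hC haC
  refine ⟨b, hb, ?_⟩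
  filter_upwards [hbC, (Besicovitch.vitaliFamily volume).ae_tendsto_average_norm_sub
    hb.locallyIntegrable] with ξ₀ h1 h2
  have h3 := h2.comp (Besicovitch.tendsto_filterAt volume ξ₀)
  have h4 : ∀ τ t : ℝ, 1 < τ → τ ^ n < t → ‖b ξ₀‖ ≤ M * t := fun τ t hτ ht =>
    ha.norm_le_of_lebesgue_point h hAX hb hbC h1 h3 hτ ht
  -- The choice t = τ^n + (τ - 1) is admissible for every τ > 1 and tends to 1.
  have h5 : Tendsto (fun τ : ℝ => M * (τ ^ n + (τ - 1))) (𝓝[>] 1) (𝓝 M) := by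
    have : Continuous fun τ : ℝ => M * (τ ^ n + (τ - 1)) := by fun_prop
    have h6 := this.tendsto 1
    simp only [one_pow, sub_self, add_zero, mul_one] at h6
    exact h6.mono_left nhdsWithin_le_nhds
  refine ge_of_tendsto h5 ?_
  filter_upwards [self_mem_nhdsWithin] with τ hτ
  exact h4 τ _ hτ (by linarith [Set.mem_Ioi.1 hτ])

end

/-! ### Banach function norms and Muckenhoupt weights. -/

section

variable {n : ℕ}

theorem IsBanachFunctionNorm.isLatticeNorm {ρ : (Rn n → ℝ≥0∞) → ℝ≥0∞}
    (h : IsBanachFunctionNorm ρ) : IsLatticeNorm ρ where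
  ae_eq_zero f hf := (h.eq_zero_iff f hf).1
  const_mul := h.const_mul
  add_le := h.add_le
  mono := h.mono
  cube_lt_top c l _ := h.indicator_lt_top _ (measurableSet_axisCube c l).nullMeasurableSet
    (volume_axisCube_ne_top c l).lt_top

theorem weightedLpNorm_indicator {p : ℝ} (hp : 1 < p) (w : Rn n → ℝ≥0∞) {E : Set (Rn n)}
    (hE : MeasurableSet E) : weightedLpNorm p w (E.indicator 1) = (∫⁻ x in E, w x ^ p) ^ (1 / p) := by
  rw [weightedLpNorm, ← lintegral_indicator hE]
  congr 1
  refine lintegral_congr fun x => ?_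
  by_cases hx : x ∈ E
  · simp [hx]
  · simp [hx, ENNReal.zero_rpow_of_pos (zero_lt_one.trans hp)]

theorem IsMuckenhoupt.lt_top {p : ℝ} {w : Rn n → ℝ≥0∞} (h : IsMuckenhoupt p w) (c : Rn n) {l : ℝ}
    (hl : 0 < l) :
    ((volume (axisCube c l))⁻¹ * ∫⁻ x in axisCube c l, w x ^ p) ^ (1 / p) *
    ((volume (axisCube c l))⁻¹ * ∫⁻ x in axisCube c l, w x ^ (-p.conjExponent)) ^
      (1 / p.conjExponent) < ∞ := by
  refine lt_of_le_of_lt ?_ h.2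
  refine le_iSup_of_le c (le_iSup_of_le l (le_iSup_of_le hl ?_))
  exact le_rfl

theorem IsMuckenhoupt.isLatticeNorm {p : ℝ} {w : Rn n → ℝ≥0∞} (hp : 1 < p)
    (h : IsMuckenhoupt p w) : IsLatticeNorm (weightedLpNorm p w) := by
  have hp0 : 0 < p := zero_lt_one.trans hp
  have hq := Real.HolderConjugate.conjExponent hp
  obtain ⟨hwm, hw⟩ := h.1
  refine ⟨fun f hf h0 => ?_, fun f hf c => ?_, fun f g hf hg => ?_, fun f g hf hg hfg => ?_,
    fun c l hl => ?_⟩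
  · have hm : AEMeasurable (fun x => (f x * w x) ^ p) volume := (hf.mul hwm).pow_const p
    rw [weightedLpNorm, ENNReal.rpow_eq_zero_iff_of_pos (by positivity),
      lintegral_eq_zero_iff' hm] at h0
    filter_upwards [h0, hw] with x hx hwx
    rw [Pi.zero_apply, ENNReal.rpow_eq_zero_iff_of_pos hp0] at hx
    exact (mul_eq_zero.1 hx).resolve_right hwx.1.ne'
  · simp only [weightedLpNorm, mul_assoc, ENNReal.mul_rpow_of_nonneg _ _ hp0.le]
    rw [lintegral_const_mul' _ _ (ENNReal.rpow_ne_top_of_nonneg hp0.le ENNReal.coe_ne_top),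
      ENNReal.mul_rpow_of_nonneg _ _ (by positivity), ← ENNReal.rpow_mul,
      mul_one_div_cancel hp0.ne', ENNReal.rpow_one]
  · have := ENNReal.lintegral_Lp_add_le (hf.mul hwm) (hg.mul hwm) hp.le
    simp only [weightedLpNorm, add_mul]
    exact this
  · refine ENNReal.rpow_le_rpow (lintegral_mono_ae ?_) (by positivity)
    filter_upwards [hfg] with x hx
    exact ENNReal.rpow_le_rpow (mul_le_mul' hx le_rfl) hp0.le
  · have hQ := measurableSet_axisCube c l
    have hv0 := volume_axisCube_ne_zero c hl
    have hvt := volume_axisCube_ne_top c l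
    rw [weightedLpNorm_indicator hp w hQ]
    -- Because w < ∞ almost everywhere, the second A_p factor is not 0. The finite product therefore
    -- makes the first factor, and so the norm of the cube, finite.
    have hY : ((volume (axisCube c l))⁻¹ * ∫⁻ x in axisCube c l, w x ^ (-p.conjExponent)) ^
        (1 / p.conjExponent) ≠ 0 := by
      intro h0
      rw [ENNReal.rpow_eq_zero_iff_of_pos (one_div_pos.2 hq.symm.pos), mul_eq_zero,
        or_iff_right (ENNReal.inv_ne_zero.2 hvt),
        lintegral_eq_zero_iff' (hwm.restrict.pow_const _)] at h0
      have h1 : ∀ᵐ x ∂volume.restrict (axisCube c l), False := by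
        filter_upwards [h0, ae_restrict_of_ae hw] with x hx hwx
        rw [Pi.zero_apply, ENNReal.rpow_neg, ENNReal.inv_eq_zero,
          ENNReal.rpow_eq_top_iff_of_pos hq.symm.pos] at hx
        exact hwx.2.ne hx
      rw [eventually_false_iff_eq_bot, ae_eq_bot, Measure.restrict_eq_zero] at h1
      exact hv0 h1
    have hX := ENNReal.lt_top_of_mul_ne_top_left (h.lt_top c hl).ne hY
    rw [ENNReal.rpow_lt_top_iff_of_pos (by positivity)] at hX
    exact ENNReal.rpow_lt_top_of_nonneg (by positivity)
      (ENNReal.lt_top_of_mul_ne_top_right hX.ne (ENNReal.inv_ne_zero.2 hvt)).ne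

/-- Hölder's inequality for f = (f w) · w⁻¹ on E. -/
theorem IsMuckenhoupt.associateNorm_le {p : ℝ} {w : Rn n → ℝ≥0∞} (hp : 1 < p)
    (h : IsMuckenhoupt p w) {E : Set (Rn n)} (hE : MeasurableSet E) :
    associateNorm (weightedLpNorm p w) (E.indicator 1) ≤
      (∫⁻ x in E, w x ^ (-p.conjExponent)) ^ (1 / p.conjExponent) := by
  have hp0 : 0 < p := zero_lt_one.trans hp
  have hq := Real.HolderConjugate.conjExponent hp
  obtain ⟨hwm, hw⟩ := h.1
  refine iSup_le fun f => iSup_le fun hf => iSup_le fun hf1 => ?_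
  have h1 : ∫⁻ x, f x * E.indicator 1 x = ∫⁻ x in E, ((fun x => f x * w x) * fun x => (w x)⁻¹) x := by
    rw [← lintegral_indicator hE]
    refine lintegral_congr_ae ?_
    filter_upwards [hw] with x hx
    by_cases hxE : x ∈ E
    · rw [Set.indicator_of_mem hxE, Set.indicator_of_mem hxE, Pi.mul_apply, mul_assoc,
        ENNReal.mul_inv_cancel hx.1.ne' hx.2.ne, Pi.one_apply]
    · rw [Set.indicator_of_notMem hxE, Set.indicator_of_notMem hxE, mul_zero]
  rw [h1]
  refine (ENNReal.lintegral_mul_le_Lp_mul_Lq _ hq (hf.mul hwm).restrict hwm.inv.restrict).trans ?_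
  have h2 : (∫⁻ x in E, (f x * w x) ^ p) ^ (1 / p) ≤ 1 :=
    (ENNReal.rpow_le_rpow (setLIntegral_le_lintegral _ _) (by positivity)).trans hf1
  refine (mul_le_mul' h2 le_rfl).trans (le_of_eq ?_)
  rw [one_mul]
  simp only [Pi.inv_apply, ENNReal.inv_rpow, ENNReal.rpow_neg]

/-- Since 1/p + 1/p' = 1, the factor |Q|⁻¹ splits into the normalizations of the two A_p averages.
-/
theorem IsMuckenhoupt.aXCondition {p : ℝ} {w : Rn n → ℝ≥0∞} (hp : 1 < p)
    (h : IsMuckenhoupt p w) : AXCondition (weightedLpNorm p w) := by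
  have hp0 : 0 < p := zero_lt_one.trans hp
  have hq := Real.HolderConjugate.conjExponent hp
  refine lt_of_le_of_lt (iSup_mono fun c => iSup_mono fun l => iSup_mono fun hl => ?_) h.2
  have hQ := measurableSet_axisCube c l
  have hsplit : (volume (axisCube c l))⁻¹ =
      (volume (axisCube c l))⁻¹ ^ (1 / p) * (volume (axisCube c l))⁻¹ ^ (1 / p.conjExponent) := by
    rw [← ENNReal.rpow_add _ _ (ENNReal.inv_ne_zero.2 (volume_axisCube_ne_top c l))
      (ENNReal.inv_ne_top.2 (volume_axisCube_ne_zero c hl)), one_div, one_div, hq.inv_add_inv_eq_one,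
      ENNReal.rpow_one]
  have hq0 := hq.symm.pos
  rw [ENNReal.mul_rpow_of_nonneg _ _ (by positivity), ENNReal.mul_rpow_of_nonneg _ _ (by positivity),
    weightedLpNorm_indicator hp w hQ]
  nth_rewrite 1 [hsplit]
  refine (mul_le_mul' le_rfl (h.associateNorm_le hp hQ)).trans (le_of_eq ?_)
  ring

/-! ### Return to the kernel exp (-i x ξ) and to the multiplier norm. -/

/-- The symbol rescaled for the Fourier transform with kernel `exp (-2πi x ξ)`. -/
noncomputable def rescaledSymbol (a : 𝓢'(Rn n, ℂ)) : 𝓢'(Rn n, ℂ) :=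
  PointwiseConvergenceCLM.precomp ℂ
    ((((2 * Real.pi) ^ n)⁻¹ : ℝ) • dil (2 * Real.pi)⁻¹ (inv_ne_zero Real.two_pi_pos.ne')) a

theorem rescaledSymbol_apply (a : 𝓢'(Rn n, ℂ)) (g : 𝓢(Rn n, ℂ)) :
    rescaledSymbol a g = (((2 * Real.pi) ^ n)⁻¹ : ℝ) •
      a (dil (2 * Real.pi)⁻¹ (inv_ne_zero Real.two_pi_pos.ne') g) :=
  TemperedDistribution.map_real_smul a _ _

theorem multiplierOp_apply (a : 𝓢'(Rn n, ℂ)) (u v : 𝓢(Rn n, ℂ)) :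
    multiplierOp a u v = rescaledSymbol a (prod (𝓕 u) (𝓕⁻ v)) := by
  rw [rescaledSymbol_apply, ← TemperedDistribution.map_real_smul]
  change a (SchwartzMap.smulLeftCLM ℂ (⇑(fourierS n u)) (fourierInvS n v)) = _
  congr 1
  have h1 : fourierS n u = dil (2 * Real.pi)⁻¹ (inv_ne_zero Real.two_pi_pos.ne') (𝓕 u) := rfl
  have h2 : fourierInvS n v = (((2 * Real.pi) ^ n)⁻¹ : ℝ) •
      dil (2 * Real.pi)⁻¹ (inv_ne_zero Real.two_pi_pos.ne') (𝓕⁻ v) := by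
    have h3 := fourierInv_dil Real.two_pi_pos.ne' v
    rw [abs_of_pos Real.two_pi_pos] at h3
    exact h3
  ext x
  rw [SchwartzMap.smulLeftCLM_apply_apply (fourierS n u).hasTemperateGrowth, h1, h2,
    ← prod_dil, ← prod_smul, prod_apply, smul_eq_mul]

theorem IsGivenBy.isMultiplierImage {a : 𝓢'(Rn n, ℂ)} {u : 𝓢(Rn n, ℂ)} {f : Rn n → ℂ}
    (h : IsGivenBy (multiplierOp a u) f) : IsMultiplierImage (rescaledSymbol a) u f :=
  ⟨h.aestronglyMeasurable, h.integrable, fun v => by rw [← multiplierOp_apply, h.eq_integral]⟩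

variable {ρ : (Rn n → ℝ≥0∞) → ℝ≥0∞}

theorem IsLatticeNorm.distNorm_eq (h : IsLatticeNorm ρ) {T : 𝓢'(Rn n, ℂ)} {f : Rn n → ℂ}
    (hf : IsGivenBy T f) : distNorm ρ T = ρ fun x => ‖f x‖ₑ := by
  refine le_antisymm (iInf₂_le f hf) (le_iInf₂ fun g hg => (h.congr hf.aestronglyMeasurable.enorm ?_).le)
  filter_upwards [hf.ae_eq hg] with x hx
  rw [hx]

theorem IsLatticeNorm.isBoundedMultiplier (h : IsLatticeNorm ρ) {a : 𝓢'(Rn n, ℂ)}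
    (ha : a ∈ multipliers ρ) :
    IsBoundedMultiplier ρ (rescaledSymbol a) (multiplierNorm ρ a).toNNReal := by
  intro u hu
  have hM : ((multiplierNorm ρ a).toNNReal : ℝ≥0∞) = multiplierNorm ρ a :=
    ENNReal.coe_toNNReal (ne_of_lt ha)
  -- The supremum defining the multiplier norm leaves out u = 0, whose image is 0.
  by_cases hu0 : u = 0
  · refine ⟨fun _ => 0, ⟨aestronglyMeasurable_const, fun v => by simp, fun v => ?_⟩, ?_⟩
    · have h0 : prod (𝓕 u) (𝓕⁻ v) = 0 := by
        ext x
        rw [prod_apply, hu0, FourierTransform.fourier_zero]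
        simp
      rw [h0]
      simp
    · simp only [enorm_zero, h.map_zero]
      exact zero_le
  · have h1 : distNorm ρ (multiplierOp a u) / ρ (fun x => ‖u x‖ₑ) ≤ multiplierNorm ρ a :=
      le_iSup₂_of_le u hu0 (le_iSup_of_le hu le_rfl)
    rw [ENNReal.div_le_iff_le_mul (Or.inr (ne_of_lt ha)) (Or.inl hu.ne)] at h1
    have h2 : distNorm ρ (multiplierOp a u) < ∞ := h1.trans_lt (ENNReal.mul_lt_top ha hu)
    obtain ⟨f, hf⟩ := iInf_lt_iff.1 h2
    obtain ⟨hf, -⟩ := iInf_lt_iff.1 hf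
    refine ⟨f, hf.isMultiplierImage, ?_⟩
    rw [← h.distNorm_eq hf, hM]
    exact h1

theorem exists_Lp_of_rescaledSymbol {a : 𝓢'(Rn n, ℂ)} {b : Rn n → ℂ}
    (hb : IsGivenBy (rescaledSymbol a) b) {M : ℝ≥0} (hbM : ∀ᵐ x, ‖b x‖ ≤ M) :
    ∃ b' : Lp ℂ ∞ (volume : Measure (Rn n)), Lp.toTemperedDistribution b' = a ∧
      eLpNorm b' ∞ volume ≤ M := by
  have hπ := Real.two_pi_pos
  have hqmp : Measure.QuasiMeasurePreserving (fun x : Rn n => (2 * Real.pi)⁻¹ • x) volume volume :=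
    ⟨by fun_prop, by
      rw [Measure.map_addHaar_smul volume (inv_ne_zero hπ.ne')]
      exact Measure.smul_absolutelyContinuous⟩
  -- The rescaled symbol is formally a(2π ·), so this dilation undoes it without changing the
  -- essential supremum.
  set B : Rn n → ℂ := fun x => b ((2 * Real.pi)⁻¹ • x) with hB
  have hBm : AEStronglyMeasurable B volume := hb.aestronglyMeasurable.comp_quasiMeasurePreserving hqmp
  have hBM : ∀ᵐ x, ‖B x‖ ≤ M := hqmp.ae hbM
  have hBLp : MemLp B ∞ volume := memLp_top_of_bound hBm M hBM
  refine ⟨hBLp.toLp B, ?_, ?_⟩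
  · ext g
    rw [Lp.toTemperedDistribution_apply]
    have h1 : ∫ x, g x • hBLp.toLp B x = ∫ x, b ((2 * Real.pi)⁻¹ • x) * g x := by
      refine integral_congr_ae ?_
      filter_upwards [hBLp.coeFn_toLp] with x hx
      rw [hx, smul_eq_mul, mul_comm]
    have h2 := integral_comp_smul_eq (fun x : Rn n => b ((2 * Real.pi)⁻¹ • x) * g x)
      (c := 2 * Real.pi)
    simp only [smul_smul, inv_mul_cancel₀ hπ.ne', one_smul, abs_of_pos hπ] at h2
    have h3 := hb.eq_integral (dil (2 * Real.pi) hπ.ne' g)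
    simp only [dil_apply] at h3
    rw [h2, rescaledSymbol_apply] at h3
    have h4 : dil (2 * Real.pi)⁻¹ (inv_ne_zero hπ.ne') (dil (2 * Real.pi) hπ.ne' g) = g := by
      ext x
      simp only [dil_apply, smul_smul, mul_inv_cancel₀ hπ.ne', one_smul]
    rw [h4] at h3
    rw [h1]
    exact (smul_right_injective ℂ (inv_ne_zero (pow_ne_zero n hπ.ne')) h3).symm
  · rw [eLpNorm_congr_ae hBLp.coeFn_toLp, eLpNorm_exponent_top]
    simpa using eLpNormEssSup_le_of_ae_bound hBM

theorem IsLatticeNorm.exists_Lp (h : IsLatticeNorm ρ) (hAX : AXCondition ρ) {a : 𝓢'(Rn n, ℂ)}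
    (ha : a ∈ multipliers ρ) :
    ∃ b : Lp ℂ ∞ (volume : Measure (Rn n)), Lp.toTemperedDistribution b = a ∧
      eLpNorm b ∞ volume ≤ multiplierNorm ρ a := by
  obtain ⟨b, hb, hbM⟩ := (h.isBoundedMultiplier ha).exists_isGivenBy h hAX
  obtain ⟨b', hb', hM⟩ := exists_Lp_of_rescaledSymbol hb hbM
  rw [ENNReal.coe_toNNReal (ne_of_lt ha)] at hM
  exact ⟨b', hb', hM⟩

/-! ### Optimality of the constant 1. -/

/-- The constant function `1` as an element of `L^∞`. -/
noncomputable def oneLp (n : ℕ) : Lp ℂ ∞ (volume : Measure (Rn n)) :=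
  (memLp_top_const (1 : ℂ)).toLp _

/-- The symbol 1 acts as the identity: the factor (2π)^(-n) cancels the Jacobian, and the
multiplication formula with Fourier inversion gives ∫ u v. -/
theorem isGivenBy_multiplierOp_oneLp (u : 𝓢(Rn n, ℂ)) :
    IsGivenBy (multiplierOp (Lp.toTemperedDistribution (oneLp n)) u) u := by
  refine ⟨u.continuous.aestronglyMeasurable, fun v => (prod u v).integrable, fun v => ?_⟩
  have h1 : ∀ g : 𝓢(Rn n, ℂ), Lp.toTemperedDistribution (oneLp n) g = ∫ x, g x := fun g => by
    rw [Lp.toTemperedDistribution_apply]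
    refine integral_congr_ae ?_
    filter_upwards [(memLp_top_const (μ := (volume : Measure (Rn n))) (1 : ℂ)).coeFn_toLp] with x hx
    rw [oneLp, hx, smul_eq_mul, mul_one]
  have h2 := integral_comp_smul_eq (prod (𝓕 u) (𝓕⁻ v)) (c := (2 * Real.pi)⁻¹)
  rw [abs_of_pos (inv_pos.2 Real.two_pi_pos), inv_pow, inv_inv] at h2
  rw [multiplierOp_apply, rescaledSymbol_apply, h1]
  simp only [dil_apply]
  rw [h2, smul_smul, inv_mul_cancel₀ (pow_ne_zero n Real.two_pi_pos.ne'), one_smul]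
  simp only [prod_apply]
  rw [integral_fourier_mul_eq, FourierTransform.fourier_fourierInv_eq]

theorem multiplierNorm_oneLp_le (ρ : (Rn n → ℝ≥0∞) → ℝ≥0∞) :
    multiplierNorm ρ (Lp.toTemperedDistribution (oneLp n)) ≤ 1 := by
  refine iSup_le fun u => iSup_le fun _ => iSup_le fun _ => ?_
  exact (ENNReal.div_le_div_right (iInf₂_le _ (isGivenBy_multiplierOp_oneLp u)) _).trans
    ENNReal.div_self_le_one

theorem one_le_of_forall_eLpNorm_le (ρ : (Rn n → ℝ≥0∞) → ℝ≥0∞) (D : ℝ≥0)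
    (hD : ∀ a ∈ multipliers ρ, ∀ b : Lp ℂ ∞ (volume : Measure (Rn n)),
      Lp.toTemperedDistribution b = a → eLpNorm b ∞ volume ≤ D * multiplierNorm ρ a) : 1 ≤ D := by
  have hle := multiplierNorm_oneLp_le ρ
  have h1 := hD _ (hle.trans_lt ENNReal.one_lt_top) (oneLp n) rfl
  have h2 : eLpNorm (oneLp n) ∞ volume = 1 := by
    rw [oneLp, eLpNorm_congr_ae (MemLp.coeFn_toLp _),
      eLpNorm_const (1 : ℂ) ENNReal.top_ne_zero (NeZero.ne volume)]
    simp
  rw [h2] at h1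
  have h3 : (1 : ℝ≥0∞) ≤ D := h1.trans ((mul_le_mul_right hle _).trans (mul_one _).le)
  exact_mod_cast h3

end

theorem mainTheorem2 (n : ℕ) (hn : 1 ≤ n) :
    (∀ (p : ℝ) (w : Rn n → ℝ≥0∞), 1 < p → IsMuckenhoupt p w →
      (∀ a ∈ multipliers (weightedLpNorm p w),
        ∃ b : Lp ℂ ∞ (volume : Measure (Rn n)), Lp.toTemperedDistribution b = a ∧
          eLpNorm b ∞ volume ≤ multiplierNorm (weightedLpNorm p w) a) ∧
      (∀ D : ℝ≥0,
        (∀ a ∈ multipliers (weightedLpNorm p w), ∀ b : Lp ℂ ∞ (volume : Measure (Rn n)),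
          Lp.toTemperedDistribution b = a →
            eLpNorm b ∞ volume ≤ D * multiplierNorm (weightedLpNorm p w) a) →
        1 ≤ D)) ∧
    (∀ ρ : (Rn n → ℝ≥0∞) → ℝ≥0∞, IsBanachFunctionNorm ρ → AXCondition ρ →
      (∀ a ∈ multipliers ρ,
        ∃ b : Lp ℂ ∞ (volume : Measure (Rn n)), Lp.toTemperedDistribution b = a ∧
          eLpNorm b ∞ volume ≤ multiplierNorm ρ a) ∧
      (∀ D : ℝ≥0,
        (∀ a ∈ multipliers ρ, ∀ b : Lp ℂ ∞ (volume : Measure (Rn n)),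
          Lp.toTemperedDistribution b = a → eLpNorm b ∞ volume ≤ D * multiplierNorm ρ a) →
        1 ≤ D)) := by
  exact ⟨fun p w hp hw => ⟨fun a ha => (hw.isLatticeNorm hp).exists_Lp (hw.aXCondition hp) ha,
      fun D hD => one_le_of_forall_eLpNorm_le _ D hD⟩,
    fun ρ hρ hAX => ⟨fun a ha => hρ.isLatticeNorm.exists_Lp hAX ha,
      fun D hD => one_le_of_forall_eLpNorm_le ρ D hD⟩⟩
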